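/- Let $\mathbb{K}$ be the C*-algebra of compact operators on $\ell^2(\mathbb{N})$, and let $A$ and $B$ be two full hereditary sub-C*-algebras of $C[0,1]\otimes\mathbb{K}=C([0,1],\mathbb{K})$ (hereditary: norm-closed *-subalgebras such that $0\le b\le a$ with $a$ in the subalgebra implies that $b$ is in it; full: contained in no proper closed two-sided ideal). Let $\hat A$ and $\hat B$ be their spectra, i.e. the sets of unitary equivalence classes of irreducible *-representations with the hull-kernel topology, and let the spectra be identified with $[0,1]$ by homeomorphisms $\alpha:[0,1]\to\hat A$ and $\beta:[0,1]\to\hat B$. Suppose that, under these identifications, $A$ and $B$ have the same dimension function $f:[0,1]\to\mathbb{N}\cup\{\infty\}$: for every $t\in[0,1]$ the irreducible representations of class $\alpha(t)$ and those of class $\beta(t)$ both act on Hilbert spaces of dimension $f(t)$. Then there is a *-isomorphism $\varphi:A\to B$ which preserves the identification of the spectra: for every $t\in[0,1]$, if $\rho$ is an irreducible representation of $B$ of class $\beta(t)$, then $\rho\circ\varphi$ is an irreducible representation of $A$ of class $\alpha(t)$. -/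

import Mathlib

noncomputable section

namespace HereditaryInterval

universe u

/-! ### Hereditary and full subalgebras -/

/-- `x` is a positive element of the C*-algebra `D`, that is, `x = c* c` for some `c` in `D`. -/
def IsPos {D : Type*} [Mul D] [Star D] (x : D) : Prop :=
  ∃ c : D, x = star c * c

/-- `A` is a hereditary sub-C*-algebra of the C*-algebra `D`: a norm-closed *-subalgebra such that
`0 ≤ b ≤ a`, `a ∈ A`, `b ∈ D` imply `b ∈ A`. -/
structure IsHereditary {D : Type*} [NonUnitalCStarAlgebra D]
    (A : NonUnitalStarSubalgebra ℂ D) : Prop where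
  isClosed : IsClosed (A : Set D)
  mem_of_le : ∀ a ∈ A, ∀ b : D, IsPos b → IsPos (a - b) → b ∈ A

/-- `A` is full in `D`: no proper closed two-sided ideal of `D` contains `A`.
(A closed two-sided ring ideal of a C*-algebra is automatically a linear subspace.) -/
def IsFull {D : Type*} [NonUnitalCStarAlgebra D] (A : NonUnitalStarSubalgebra ℂ D) : Prop :=
  ∀ J : TwoSidedIdeal D, IsClosed (J : Set D) → (∀ a ∈ A, a ∈ J) → J = ⊤

/-! ### Irreducible representations and the spectrum -/

/-- A (topologically) irreducible *-representation of `A` on a complex Hilbert space: it is nonzero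
and has no closed invariant subspaces besides `0` and the whole space. Such a representation is
cyclic, hence unitarily equivalent to one on a Hilbert space in the universe of `A`. -/
structure IrrRep (A : Type u) [NonUnitalRing A] [Module ℂ A] [Star A] where
  space : Type u
  [normed : NormedAddCommGroup space]
  [inner : InnerProductSpace ℂ space]
  [complete : CompleteSpace space]
  toHom : A →⋆ₙₐ[ℂ] (space →L[ℂ] space)
  nonzero : ∃ a : A, toHom a ≠ 0
  irreducible : ∀ W : Submodule ℂ space, IsClosed (W : Set space) →
    (∀ a : A, ∀ w ∈ W, toHom a w ∈ W) → W = ⊥ ∨ W = ⊤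

attribute [instance] IrrRep.normed IrrRep.inner IrrRep.complete

section Spectrum

variable {A B : Type u} [NonUnitalRing A] [Module ℂ A] [Star A]
  [NonUnitalRing B] [Module ℂ B] [Star B]

/-- Unitary equivalence of irreducible representations. -/
def IrrRep.Equivalent (π ρ : IrrRep A) : Prop :=
  ∃ U : π.space ≃ₗᵢ[ℂ] ρ.space, ∀ (a : A) (x : π.space), U (π.toHom a x) = ρ.toHom a (U x)

theorem IrrRep.Equivalent.refl (π : IrrRep A) : π.Equivalent π :=
  ⟨LinearIsometryEquiv.refl ℂ π.space, fun _ _ => rfl⟩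

theorem IrrRep.Equivalent.symm {π ρ : IrrRep A} (h : π.Equivalent ρ) : ρ.Equivalent π := by
  obtain ⟨U, hU⟩ := h
  refine ⟨U.symm, fun a x => ?_⟩
  rw [LinearIsometryEquiv.symm_apply_eq, hU, LinearIsometryEquiv.apply_symm_apply]

theorem IrrRep.Equivalent.trans {π ρ σ : IrrRep A} (h : π.Equivalent ρ) (h' : ρ.Equivalent σ) :
    π.Equivalent σ := by
  obtain ⟨U, hU⟩ := h
  obtain ⟨V, hV⟩ := h'
  exact ⟨U.trans V, fun a x => by simp [hU, hV]⟩

variable (A) in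
instance IrrRep.setoid : Setoid (IrrRep A) where
  r := IrrRep.Equivalent
  iseqv := ⟨IrrRep.Equivalent.refl, IrrRep.Equivalent.symm, IrrRep.Equivalent.trans⟩

variable (A) in
/-- The spectrum of `A`: the set of unitary equivalence classes of irreducible representations. -/
def Spectrum : Type (u + 1) := Quotient (IrrRep.setoid A)

/-- The class of an irreducible representation in the spectrum. -/
def IrrRep.toSpectrum (π : IrrRep A) : Spectrum A := Quotient.mk (IrrRep.setoid A) π

/-- The kernel of (any representation in) a point of the spectrum. -/
def Spectrum.kernel (σ : Spectrum A) : Set A :=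
  Quotient.lift (fun π : IrrRep A => {a : A | π.toHom a = 0}) (by
    have key : ∀ π ρ : IrrRep A, π.Equivalent ρ → ∀ a : A, π.toHom a = 0 → ρ.toHom a = 0 := by
      rintro π ρ ⟨U, hU⟩ a ha
      ext y
      have h := hU a (U.symm y)
      rw [ha, LinearIsometryEquiv.apply_symm_apply] at h
      simpa using h.symm
    intro π ρ h
    ext a
    exact ⟨key π ρ h a, key ρ π (IrrRep.Equivalent.symm h) a⟩) σ

/-- The hull-kernel (Jacobson) topology on the spectrum: its open sets are
`{σ | σ does not vanish on J}` for two-sided ideals `J`. -/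
instance : TopologicalSpace (Spectrum A) :=
  TopologicalSpace.generateFrom
    (Set.range fun J : TwoSidedIdeal A => {σ : Spectrum A | ∃ a ∈ J, a ∉ σ.kernel})

/-- The dimension function on the spectrum, with values in `ℕ ∪ {∞}`: it sends the class of an
irreducible representation to the dimension of the Hilbert space on which it acts. -/
def Spectrum.dim (σ : Spectrum A) : ℕ∞ :=
  Quotient.lift (fun π : IrrRep A => Cardinal.toENat (Module.rank ℂ π.space)) (by
    rintro π ρ ⟨U, -⟩
    exact congrArg _ U.toLinearEquiv.rank_eq) σ

/-- The irreducible representation `ρ ∘ φ` of `A` obtained from a *-isomorphism `φ : A → B` and an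
irreducible representation `ρ` of `B`. -/
def IrrRep.comp (ρ : IrrRep B) (φ : A ≃⋆ₐ[ℂ] B) : IrrRep A where
  space := ρ.space
  toHom := ρ.toHom.comp (φ : A →⋆ₙₐ[ℂ] B)
  nonzero := by
    obtain ⟨b, hb⟩ := ρ.nonzero
    exact ⟨φ.symm b, by simpa using hb⟩
  irreducible := fun W hW h => ρ.irreducible W hW fun b w hw => by
    simpa using h (φ.symm b) w hw

/-- The map `[ρ] ↦ [ρ ∘ φ]` of spectra induced by a *-isomorphism `φ : A → B`. -/
def Spectrum.comap (φ : A ≃⋆ₐ[ℂ] B) (τ : Spectrum B) : Spectrum A :=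
  Quotient.lift (fun ρ : IrrRep B => (ρ.comp φ).toSpectrum) (by
    rintro π ρ ⟨U, hU⟩
    exact Quotient.sound ⟨U, fun a x => hU (φ a) x⟩) τ

end Spectrum

/-! ### The C*-algebra `C[0,1] ⊗ 𝕂` -/

/-- The separable infinite-dimensional complex Hilbert space `ℓ²(ℕ)`. -/
abbrev Hilb : Type := lp (fun _ : ℕ => ℂ) 2

theorem isCompactOperator_star {T : Hilb →L[ℂ] Hilb} (hT : IsCompactOperator T) :
    IsCompactOperator (star T : Hilb →L[ℂ] Hilb) := by
  rw [ContinuousLinearMap.star_eq_adjoint]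
  set S : Hilb →L[ℂ] Hilb := ContinuousLinearMap.adjoint T with hS
  have hTS : IsCompactOperator (T ∘L S) := hT.comp_clm S
  have htb : TotallyBounded ((T ∘L S) '' Metric.closedBall 0 1) :=
    (hTS.isCompact_closure_image_closedBall (𝕜₁ := ℂ) (f := (T ∘L S).toLinearMap)
      1).totallyBounded.subset subset_closure
  refine (isCompactOperator_iff_isCompact_closure_image_closedBall
    (S : Hilb →ₗ[ℂ] Hilb) zero_lt_one).2 ?_
  refine TotallyBounded.isCompact_of_isClosed (TotallyBounded.closure ?_) isClosed_closure
  rw [Metric.totallyBounded_iff]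
  intro ε hε
  obtain ⟨t, hts, htf, ht⟩ := Metric.finite_approx_of_totallyBounded htb (ε ^ 2 / 2) (by positivity)
  have hts' : ∀ y : Hilb, ∃ x : Hilb, y ∈ t → x ∈ Metric.closedBall (0 : Hilb) 1 ∧
      (T ∘L S) x = y := fun y => by
    by_cases hy : y ∈ t
    · obtain ⟨x, hx, hxy⟩ := hts hy
      exact ⟨x, fun _ => ⟨hx, hxy⟩⟩
    · exact ⟨0, fun h => absurd h hy⟩
  choose g hg using hts'
  refine ⟨(fun y : Hilb => S (g y)) '' t, htf.image _, ?_⟩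
  rintro _ ⟨x, hx, rfl⟩
  obtain ⟨y, hy, hxy⟩ := Set.mem_iUnion₂.1 (ht ⟨x, hx, rfl⟩)
  refine Set.mem_iUnion₂.2 ⟨S (g y), ⟨y, hy, rfl⟩, ?_⟩
  obtain ⟨hgy, hgy'⟩ := hg y hy
  rw [mem_closedBall_zero_iff] at hx hgy
  rw [Metric.mem_ball, dist_eq_norm, ← hgy', ← map_sub] at hxy
  change dist (S x) (S (g y)) < ε
  rw [dist_eq_norm, ← map_sub]
  set z := x - g y with hz
  have hz2 : ‖z‖ ≤ 2 := (norm_sub_le _ _).trans (by linarith)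
  have h1 : ‖S z‖ ^ 2 ≤ ‖(T ∘L S) z‖ * ‖z‖ := by
    have h2 : inner ℂ (S z) (S z) = inner ℂ z ((T ∘L S) z) := by
      rw [hS, ContinuousLinearMap.adjoint_inner_left]
      rfl
    calc ‖S z‖ ^ 2 = ‖(inner ℂ (S z) (S z) : ℂ)‖ := by
          rw [inner_self_eq_norm_sq_to_K]; simp
      _ = ‖(inner ℂ z ((T ∘L S) z) : ℂ)‖ := by rw [h2]
      _ ≤ ‖z‖ * ‖(T ∘L S) z‖ := norm_inner_le_norm _ _
      _ = _ := mul_comm _ _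
  have h3 : ‖S z‖ ^ 2 < ε ^ 2 := by
    have := norm_nonneg ((T ∘L S) z)
    nlinarith [norm_nonneg z]
  exact lt_of_pow_lt_pow_left₀ 2 hε.le h3

/-- The C*-algebra `𝕂` of compact operators on `ℓ²(ℕ)`. -/
def compactOps : NonUnitalStarSubalgebra ℂ (Hilb →L[ℂ] Hilb) where
  carrier := {T | IsCompactOperator T}
  add_mem' := fun hS hT => IsCompactOperator.add hS hT
  zero_mem' := isCompactOperator_zero
  mul_mem' := fun {S _} _ hT => IsCompactOperator.clm_comp hT S
  smul_mem' := fun c _ hT => IsCompactOperator.smul hT c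
  star_mem' := fun hT => isCompactOperator_star hT

instance : IsClosed (compactOps : Set (Hilb →L[ℂ] Hilb)) :=
  isClosed_setOfPred_isCompactOperator

/-- The C*-algebra `C[0,1] ⊗ 𝕂` of continuous functions from `[0,1]` to the compact operators. -/
def StableInterval : Type := C(unitInterval, compactOps)

instance : NonUnitalCStarAlgebra compactOps := inferInstance

instance : NonUnitalCStarAlgebra StableInterval :=
  inferInstanceAs (NonUnitalCStarAlgebra C(unitInterval, compactOps))

end HereditaryInterval

end

noncomputable section

namespace HereditaryInterval

open Set Filter Topology InnerProductSpace

section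

/-! ### Continuous fields of Hilbert spaces over the interval -/

/-! A hereditary subalgebra `A` of C([0,1], 𝕂) is determined by its essential subspaces H_t, the
closed spans of the ranges of a(t), a ∈ `A`: an element d lies in `A` as soon as d(t) and d(t)* map
into H_t for every t (`IsHereditary.mem_of_eval`). Every irreducible representation of `A` factors
through evaluation at some t (`IsHereditary.exists_factor`) and is then equivalent to the action on
H_t (`IsHereditary.fiberRep_equivalent`); fullness makes every H_t nonzero. Thus the spectrum is
canonically [0,1], any given identification differs from the canonical one by a homeomorphism, and,
up to that homeomorphism, f is the dimension of H_t.

It remains to see that the dimension determines the field (H_t). This rests on the base being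
one-dimensional: a continuous map [0,1] → ℂ can be perturbed so as to avoid 0. Hence, by Baire,
every section can be perturbed so as to vanish only where the fibre is zero (`exists_section_near`).
Gram–Schmidt with such a perturbation at each stage yields orthogonal sections e_n, total in every
fibre, with e_n(t) = 0 exactly when dim H_t ≤ n (`frame_eq_zero_iff`).

After normalization, the frames of `A` and `B` have equal Gram matrices at corresponding points, so
partial isometries u(s) carry one to the other. Normalized sections may jump at their zeros, but
conjugation by u still preserves norm continuity (`continuous_conj`), since a compact operator at a
point is approximated using only the frame vectors that are nonzero there. This conjugation is the
required isomorphism. -/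

/-- A continuous complex function on the unit interval is a uniform limit of nonvanishing ones. -/
theorem exists_nonvanishing_near (r : C(unitInterval, ℂ)) {ε : ℝ} (hε : 0 < ε) :
    ∃ k : C(unitInterval, ℂ), (∀ t, ‖k t - r t‖ < ε) ∧ ∀ t, k t ≠ 0 := by
  obtain ⟨p, hp⟩ := exists_polynomial_near_continuousMap 0 1
    (⟨fun t => (r t).re, by fun_prop⟩ : C(unitInterval, ℝ)) (ε / 4) (by positivity)
  obtain ⟨q, hq⟩ := exists_polynomial_near_continuousMap 0 1
    (⟨fun t => (r t).im, by fun_prop⟩ : C(unitInterval, ℝ)) (ε / 4) (by positivity)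
  have hp' : ∀ t : unitInterval, |p.eval (t : ℝ) - (r t).re| < ε / 4 := fun t =>
    (ContinuousMap.norm_coe_le_norm (p.toContinuousMapOn _ - _) t).trans_lt hp
  have hq' : ∀ t : unitInterval, |q.eval (t : ℝ) - (r t).im| < ε / 4 := fun t =>
    (ContinuousMap.norm_coe_le_norm (q.toContinuousMapOn _ - _) t).trans_lt hq
  set g : ℝ → ℂ := fun x => ((p.eval x : ℝ) : ℂ) + ((q.eval x : ℝ) : ℂ) * Complex.I with hg
  have hgs : ContDiff ℝ 1 g := by
    have h1 : ContDiff ℝ 1 fun x : ℝ => p.eval x := by simpa using p.contDiff_aeval (𝕜 := ℝ) 1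
    have h2 : ContDiff ℝ 1 fun x : ℝ => q.eval x := by simpa using q.contDiff_aeval (𝕜 := ℝ) 1
    exact (Complex.ofRealCLM.contDiff.comp h1).add
      ((Complex.ofRealCLM.contDiff.comp h2).mul contDiff_const)
  -- A C¹ curve in the plane has a range with dense complement, so a small translation by some c off
  -- the range removes all zeros.
  have hd := hgs.dense_compl_range_of_finrank_lt_finrank (by simp [Complex.finrank_real_complex])
  obtain ⟨c, hc, hcε⟩ := hd.exists_dist_lt 0 (show 0 < ε / 4 by positivity)
  refine ⟨⟨fun t => g t - c, by have := hgs.continuous; fun_prop⟩, fun t => ?_, fun t h => ?_⟩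
  · have h1 : ‖g t - r t‖ ≤ |p.eval (t : ℝ) - (r t).re| + |q.eval (t : ℝ) - (r t).im| := by
      have := Complex.norm_le_abs_re_add_abs_im (g t - r t)
      simpa [hg] using this
    have h2 : ‖c‖ < ε / 4 := by simpa using hcε
    calc ‖g t - c - r t‖ = ‖(g t - r t) - c‖ := by congr 1; ring
      _ ≤ ‖g t - r t‖ + ‖c‖ := norm_sub_le _ _
      _ < ε := by linarith [hp' t, hq' t]
  · exact hc ⟨t, sub_eq_zero.1 h⟩

variable {H : Type*} [NormedAddCommGroup H] [InnerProductSpace ℂ H]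

variable (H) in
/-- A (separable) continuous field of Hilbert spaces over the unit interval inside a constant
field: closed subspaces of `H`, with a sequence of continuous sections which is dense in
every fibre. -/
structure HilbertField where
  fiber : unitInterval → Submodule ℂ H
  isClosed_fiber : ∀ t, IsClosed (fiber t : Set H)
  sec : ℕ → C(unitInterval, H)
  sec_mem : ∀ k t, sec k t ∈ fiber t
  subset_closure : ∀ t, (fiber t : Set H) ⊆ closure (range fun k => sec k t)

namespace HilbertField

/-- The continuous sections of a field of Hilbert spaces. -/
def sections (V : HilbertField H) : Set C(unitInterval, H) := {ξ | ∀ t, ξ t ∈ V.fiber t}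

theorem isClosed_sections (V : HilbertField H) : IsClosed V.sections := by
  have : V.sections = ⋂ t, (fun ξ : C(unitInterval, H) => ξ t) ⁻¹' (V.fiber t : Set H) := by
    ext; simp [sections]
  rw [this]
  exact isClosed_iInter fun t => (V.isClosed_fiber t).preimage (continuous_eval_const t)

/-- Sections can be perturbed so as not to vanish where a given section is bounded below. -/
theorem exists_section_ne_zero_on (V : HilbertField H) (η ξ : C(unitInterval, H))
    (hη : η ∈ V.sections) (hξ : ξ ∈ V.sections) {δ ε : ℝ} (hδ : 0 < δ) (hε : 0 < ε) :
    ∃ ζ ∈ V.sections, dist ζ ξ < ε ∧ ∀ t, δ ≤ ‖η t‖ → ζ t ≠ 0 := by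
  have hm : ∀ t, ((max (‖η t‖ ^ 2) (δ ^ 2) : ℝ) : ℂ) ≠ 0 := fun t => by
    have : 0 < max (‖η t‖ ^ 2) (δ ^ 2) := lt_max_of_lt_right (by positivity)
    exact_mod_cast this.ne'
  -- r is the coefficient of ξ along η, with the denominator cut off below at δ² to keep it
  -- continuous. Replacing r by a nonvanishing k gives a section ζ with ⟨η, ζ⟩ = k‖η‖² wherever ‖η‖
  -- ≥ δ.
  let r : C(unitInterval, ℂ) := ⟨fun t => inner ℂ (η t) (ξ t) / ((max (‖η t‖ ^ 2) (δ ^ 2) : ℝ) : ℂ), by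
    refine Continuous.div (by fun_prop) (by fun_prop) hm⟩
  obtain ⟨k, hk, hk0⟩ := exists_nonvanishing_near r (ε := ε / 2 / (‖η‖ + 1)) (by positivity)
  refine ⟨ξ + (⟨fun t => (k t - r t) • η t, by fun_prop⟩ : C(unitInterval, H)),
    fun t => (V.fiber t).add_mem (hξ t) ((V.fiber t).smul_mem _ (hη t)), ?_, fun t ht h0 => ?_⟩
  · rw [dist_eq_norm, add_sub_cancel_left]
    refine lt_of_le_of_lt ((ContinuousMap.norm_le _ (by positivity)).2 fun t => ?_)
      (half_lt_self hε)
    calc ‖(k t - r t) • η t‖ = ‖k t - r t‖ * ‖η t‖ := norm_smul _ _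
      _ ≤ ε / 2 / (‖η‖ + 1) * (‖η‖ + 1) := by
        gcongr
        · exact (hk t).le
        · linarith [η.norm_coe_le_norm t]
      _ = ε / 2 := by field_simp
  · apply hk0 t
    have hmt : max (‖η t‖ ^ 2) (δ ^ 2) = ‖η t‖ ^ 2 := max_eq_left (by gcongr)
    have h1 := hm t
    have h2 : inner ℂ (η t) (ξ t + (k t - r t) • η t) = 0 := by
      rw [show ξ t + (k t - r t) • η t = 0 from h0, inner_zero_right]
    have h3 : r t * (((max (‖η t‖ ^ 2) (δ ^ 2) : ℝ) : ℂ)) = inner ℂ (η t) (ξ t) :=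
      div_mul_cancel₀ _ h1
    rw [inner_add_right, inner_smul_right, inner_self_eq_norm_sq_to_K, ← h3, hmt] at h2
    rw [hmt] at h1
    push_cast at h1 h2
    have h4 : k t * ((‖η t‖ : ℂ) ^ 2) = 0 := by
      simp only [Complex.coe_algebraMap] at h2
      linear_combination h2
    exact (mul_eq_zero.1 h4).resolve_right h1

/-- General position: every section is a limit of sections that vanish only where the fibre
does. -/
theorem exists_section_near [CompleteSpace H] (V : HilbertField H) (ξ : C(unitInterval, H)) (hξ : ξ ∈ V.sections)
    {ε : ℝ} (hε : 0 < ε) :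
    ∃ ζ ∈ V.sections, dist ζ ξ < ε ∧ ∀ t, ζ t = 0 → V.fiber t = ⊥ := by
  have : CompleteSpace V.sections := V.isClosed_sections.completeSpace_coe
  -- Baire argument in the complete space of sections: these countably many compact sets cover all
  -- points with nonzero fibre, and nonvanishing on each of them is an open dense condition.
  let K : ℕ × ℕ → Set unitInterval := fun i => {t | 1 / ((i.2 : ℝ) + 1) ≤ ‖V.sec i.1 t‖}
  have hK : ∀ i, IsCompact (K i) := fun i => by
    refine IsClosed.isCompact (isClosed_le (by fun_prop) (by fun_prop))
  let G : ℕ × ℕ → Set V.sections := fun i => {ζ | MapsTo ζ.1 (K i) {0}ᶜ}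
  have hGo : ∀ i, IsOpen (G i) := fun i =>
    (ContinuousMap.isOpen_setOfPred_mapsTo (hK i) isOpen_compl_singleton).preimage
      continuous_subtype_val
  have hGd : ∀ i, Dense (G i) := fun i => by
    rw [Metric.dense_iff]
    rintro ⟨x, hx⟩ ρ hρ
    obtain ⟨ζ, hζ, hd, h0⟩ := V.exists_section_ne_zero_on (V.sec i.1) x (V.sec_mem i.1) hx
      (δ := 1 / ((i.2 : ℝ) + 1)) (by positivity) hρ
    exact ⟨⟨ζ, hζ⟩, hd, fun t ht => h0 t ht⟩
  obtain ⟨ζ, hζ, hd⟩ := (dense_iInter_of_isOpen hGo hGd).exists_dist_lt ⟨ξ, hξ⟩ hε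
  refine ⟨ζ.1, ζ.2, by rw [dist_comm]; exact hd, fun t h0 => ?_⟩
  by_contra hV
  obtain ⟨x, hx, hx0⟩ := (Submodule.ne_bot_iff _).1 hV
  obtain ⟨_, ⟨k, rfl⟩, hk⟩ := Metric.mem_closure_iff.1 (V.subset_closure t hx) ‖x‖ (norm_pos_iff.2 hx0)
  have hk0 : 0 < ‖V.sec k t‖ := by
    rw [norm_pos_iff]
    intro h
    simp [h] at hk
  obtain ⟨m, hm⟩ := exists_nat_one_div_lt hk0
  exact mem_iInter.1 hζ (k, m) (show t ∈ K (k, m) from hm.le) h0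

/-! ### Gram–Schmidt orthogonalization of a field -/

/-- The component of `η` orthogonal to `ζ`. -/
def orthPart (ζ η : unitInterval → H) (t : unitInterval) : H :=
  η t - (inner ℂ (ζ t) (η t) / ((‖ζ t‖ ^ 2 : ℝ) : ℂ)) • ζ t

theorem norm_proj_le (x y : H) : ‖(inner ℂ x y / ((‖x‖ ^ 2 : ℝ) : ℂ)) • x‖ ≤ ‖y‖ := by
  rcases eq_or_ne x 0 with rfl | hx
  · simp
  have h := norm_pos_iff.2 hx
  rw [norm_smul, norm_div, Complex.norm_real, Real.norm_of_nonneg (by positivity), div_mul_eq_mul_div,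
    div_le_iff₀ (by positivity)]
  nlinarith [norm_inner_le_norm (𝕜 := ℂ) x y]

theorem inner_orthPart (ζ η : unitInterval → H) (t : unitInterval) :
    inner ℂ (ζ t) (orthPart ζ η t) = 0 := by
  rcases eq_or_ne (ζ t) 0 with h | h
  · simp [h]
  have h' : (‖ζ t‖ : ℂ) ≠ 0 := by exact_mod_cast (norm_pos_iff.2 h).ne'
  rw [orthPart, inner_sub_right, inner_smul_right, inner_self_eq_norm_sq_to_K]
  simp only [Complex.coe_algebraMap]
  push_cast
  field_simp
  ring

/-- Away from the zeros of ζ the quotient is continuous; at a zero, both η and its projection are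
bounded by ‖η‖, which tends to 0 there. -/
theorem continuous_orthPart (ζ η : C(unitInterval, H)) (h : ∀ t, ζ t = 0 → η t = 0) :
    Continuous (orthPart ζ η) := by
  rw [continuous_iff_continuousAt]
  intro t
  by_cases h0 : ζ t = 0
  · have hη := h t h0
    have h1 : orthPart ζ η t = 0 := by simp [orthPart, h0, hη]
    rw [ContinuousAt, h1]
    refine squeeze_zero_norm (a := fun s => ‖η s‖ + ‖η s‖) (fun s => ?_) ?_
    · exact (norm_sub_le _ _).trans (add_le_add le_rfl (norm_proj_le _ _))
    · have : Continuous fun s => ‖η s‖ + ‖η s‖ := by fun_prop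
      simpa [hη] using this.tendsto t
  · have h' : ((‖ζ t‖ ^ 2 : ℝ) : ℂ) ≠ 0 := by
      have := (norm_pos_iff.2 h0)
      exact_mod_cast (by positivity : ‖ζ t‖ ^ 2 ≠ 0)
    unfold orthPart
    refine ContinuousAt.sub (by fun_prop) (ContinuousAt.smul (ContinuousAt.div ?_ ?_ h') (by fun_prop))
    · exact (by fun_prop : Continuous fun s => inner ℂ (ζ s) (η s)).continuousAt
    · exact (by fun_prop : Continuous fun s => ((‖ζ s‖ ^ 2 : ℝ) : ℂ)).continuousAt

/-- The orthogonal complement of a section in a field of Hilbert spaces. -/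
def compl (V : HilbertField H) (ζ : C(unitInterval, H)) (hζ : ζ ∈ V.sections)
    (h0 : ∀ t, ζ t = 0 → V.fiber t = ⊥) : HilbertField H where
  fiber t := V.fiber t ⊓ (ℂ ∙ ζ t)ᗮ
  isClosed_fiber t := (V.isClosed_fiber t).inter (Submodule.isClosed_orthogonal _)
  sec k := ⟨orthPart ζ (V.sec k), continuous_orthPart ζ (V.sec k) fun t ht => by
    have := V.sec_mem k t
    rwa [h0 t ht, Submodule.mem_bot] at this⟩
  sec_mem k t := ⟨(V.fiber t).sub_mem (V.sec_mem k t) ((V.fiber t).smul_mem _ (hζ t)),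
    Submodule.mem_orthogonal_singleton_iff_inner_right.2 (inner_orthPart _ _ _)⟩
  subset_closure t := by
    rintro x ⟨hx, hx'⟩
    rw [SetLike.mem_coe, Submodule.mem_orthogonal_singleton_iff_inner_right] at hx'
    rw [Metric.mem_closure_iff]
    intro ε hε
    obtain ⟨_, ⟨k, rfl⟩, hk⟩ := Metric.mem_closure_iff.1 (V.subset_closure t hx) (ε / 2) (by positivity)
    refine ⟨_, ⟨k, rfl⟩, ?_⟩
    -- As x is orthogonal to ζ(t), the error is x - sec minus its own projection on ζ(t), hence at
    -- most twice ‖x - sec‖.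
    have h1 : x - orthPart ζ (V.sec k) t
        = (x - V.sec k t) - (inner ℂ (ζ t) (x - V.sec k t) / ((‖ζ t‖ ^ 2 : ℝ) : ℂ)) • ζ t := by
      rw [orthPart, inner_sub_right, hx', zero_sub, neg_div, neg_smul]
      abel
    change dist x (orthPart ζ (V.sec k) t) < ε
    rw [dist_eq_norm] at hk ⊢
    rw [h1]
    have := norm_proj_le (ζ t) (x - V.sec k t)
    calc _ ≤ _ := norm_sub_le _ _
      _ < ε := by linarith

variable [CompleteSpace H]

/-- A section close to a given fundamental one which vanishes only where the fibre does. -/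
def pick (V : HilbertField H) (n : ℕ) : C(unitInterval, H) :=
  (V.exists_section_near (V.sec n.unpair.1) (V.sec_mem _) (Nat.one_div_pos_of_nat (n := n))).choose

theorem pick_spec (V : HilbertField H) (n : ℕ) : V.pick n ∈ V.sections ∧
    dist (V.pick n) (V.sec n.unpair.1) < 1 / ((n : ℝ) + 1) ∧
    ∀ t, V.pick n t = 0 → V.fiber t = ⊥ :=
  (V.exists_section_near (V.sec n.unpair.1) (V.sec_mem _)
    (Nat.one_div_pos_of_nat (n := n))).choose_spec

/-- The successive orthogonal complements in the Gram–Schmidt process. -/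
def residual (V : HilbertField H) : ℕ → HilbertField H
  | 0 => V
  | n + 1 => (V.residual n).compl ((V.residual n).pick n) ((V.residual n).pick_spec n).1
      ((V.residual n).pick_spec n).2.2

/-- The sections produced by the Gram–Schmidt process. -/
def frame (V : HilbertField H) (n : ℕ) : C(unitInterval, H) := (V.residual n).pick n

theorem fiber_residual_succ (V : HilbertField H) (n : ℕ) (t : unitInterval) :
    (V.residual (n + 1)).fiber t = (V.residual n).fiber t ⊓ (ℂ ∙ V.frame n t)ᗮ := rfl

theorem sec_residual_succ (V : HilbertField H) (n k : ℕ) (t : unitInterval) :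
    (V.residual (n + 1)).sec k t = orthPart (V.frame n) ((V.residual n).sec k) t := rfl

theorem frame_mem_residual (V : HilbertField H) (n : ℕ) (t : unitInterval) :
    V.frame n t ∈ (V.residual n).fiber t :=
  ((V.residual n).pick_spec n).1 t

theorem fiber_residual_antitone (V : HilbertField H) (t : unitInterval) :
    Antitone fun n => (V.residual n).fiber t :=
  antitone_nat_of_succ_le fun n => by rw [fiber_residual_succ]; exact inf_le_left

theorem frame_mem (V : HilbertField H) (n : ℕ) (t : unitInterval) : V.frame n t ∈ V.fiber t :=
  V.fiber_residual_antitone t (Nat.zero_le n) (V.frame_mem_residual n t)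

theorem inner_frame_of_mem (V : HilbertField H) {n m : ℕ} (h : n < m) (t : unitInterval) {x : H}
    (hx : x ∈ (V.residual m).fiber t) : inner ℂ (V.frame n t) x = 0 := by
  have := V.fiber_residual_antitone t (Nat.succ_le_of_lt h) hx
  exact Submodule.mem_orthogonal_singleton_iff_inner_right.1 this.2

theorem inner_frame (V : HilbertField H) (t : unitInterval) {n m : ℕ} (h : n ≠ m) :
    inner ℂ (V.frame n t) (V.frame m t) = 0 := by
  rcases h.lt_or_gt with h | h
  · exact V.inner_frame_of_mem h t (V.frame_mem_residual m t)
  · rw [← inner_conj_symm, V.inner_frame_of_mem h t (V.frame_mem_residual n t), map_zero]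

theorem mem_residual_of_inner (V : HilbertField H) (t : unitInterval) {x : H} (hx : x ∈ V.fiber t)
    (n : ℕ) (h : ∀ i < n, inner ℂ (V.frame i t) x = 0) : x ∈ (V.residual n).fiber t := by
  induction n with
  | zero => exact hx
  | succ n ih => exact ⟨ih fun i hi => h i (hi.trans n.lt_succ_self),
      Submodule.mem_orthogonal_singleton_iff_inner_right.2 (h n n.lt_succ_self)⟩

/-- Each stage subtracts only a multiple of a frame vector. So, against a vector orthogonal to the
frame, a fundamental section may be replaced by its residual. -/
theorem sub_residual_mem_span (V : HilbertField H) (t : unitInterval) (k n : ℕ) :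
    V.sec k t - (V.residual n).sec k t ∈ Submodule.span ℂ (range fun i => V.frame i t) := by
  induction n with
  | zero => simp [residual]
  | succ n ih =>
    rw [sec_residual_succ, orthPart, ← sub_add]
    exact add_mem ih (Submodule.smul_mem _ _ (Submodule.subset_span ⟨n, rfl⟩))

theorem eq_zero_of_inner_frame (V : HilbertField H) (t : unitInterval) {x : H}
    (hx : x ∈ V.fiber t) (h : ∀ i, inner ℂ (V.frame i t) x = 0) : x = 0 := by
  by_contra hx0
  have hpos := norm_pos_iff.2 hx0
  obtain ⟨_, ⟨k, rfl⟩, hk⟩ := Metric.mem_closure_iff.1 (V.subset_closure t hx) (‖x‖ / 2) (by positivity)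
  obtain ⟨N, hN⟩ := exists_nat_one_div_lt (half_pos hpos)
  -- Stage n = pair(k, N) treats the k-th fundamental section, with tolerance 1/(n+1) ≤ 1/(N+1) <
  -- ‖x‖/2.
  set n := Nat.pair k N with hn
  have hnN : (N : ℝ) ≤ n := by exact_mod_cast Nat.right_le_pair k N
  have h1 : dist (V.frame n t) ((V.residual n).sec k t) < ‖x‖ / 2 := by
    have := ((V.residual n).pick_spec n).2.1
    rw [show n.unpair.1 = k by simp [hn]] at this
    refine ((ContinuousMap.dist_apply_le_dist t).trans_lt this).trans (lt_of_le_of_lt ?_ hN)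
    gcongr
  have h2 : inner ℂ (V.sec k t - (V.residual n).sec k t) x = 0 := by
    have h3 : Submodule.span ℂ (range fun i => V.frame i t) ≤ (ℂ ∙ x)ᗮ := by
      rw [Submodule.span_le]
      rintro _ ⟨i, rfl⟩
      exact Submodule.mem_orthogonal_singleton_iff_inner_left.2 (h i)
    exact Submodule.mem_orthogonal_singleton_iff_inner_left.1 (h3 (V.sub_residual_mem_span t k n))
  -- Both sec - residual and the n-th frame vector are orthogonal to x. The two remaining terms are
  -- each less than ‖x‖²/2, a contradiction.
  have h4 : inner ℂ x x = inner ℂ (x - V.sec k t) x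
      + inner ℂ ((V.residual n).sec k t - V.frame n t) x := by
    rw [inner_sub_left] at h2
    rw [inner_sub_left, inner_sub_left, h n]
    linear_combination h2
  have h5 : ‖x‖ ^ 2 ≤ ‖x - V.sec k t‖ * ‖x‖ + ‖(V.residual n).sec k t - V.frame n t‖ * ‖x‖ := by
    have : ‖(inner ℂ x x : ℂ)‖ = ‖x‖ ^ 2 := by rw [inner_self_eq_norm_sq_to_K]; simp
    rw [← this, h4]
    exact (norm_add_le _ _).trans (add_le_add (norm_inner_le_norm _ _) (norm_inner_le_norm _ _))
  rw [dist_eq_norm] at hk h1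
  rw [← norm_neg, neg_sub] at h1
  nlinarith

theorem fiber_le_closure_span_frame (V : HilbertField H) (t : unitInterval) :
    V.fiber t ≤ (Submodule.span ℂ (range fun i => V.frame i t)).topologicalClosure := by
  intro x hx
  set S := (Submodule.span ℂ (range fun i => V.frame i t)).topologicalClosure
  have : CompleteSpace S := (Submodule.isClosed_topologicalClosure _).completeSpace_coe
  have hS : S ≤ V.fiber t := Submodule.topologicalClosure_minimal _ (Submodule.span_le.2 (by
    rintro _ ⟨i, rfl⟩
    exact V.frame_mem i t)) (V.isClosed_fiber t)
  have h1 := V.eq_zero_of_inner_frame t (x := x - S.starProjection x)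
    ((V.fiber t).sub_mem hx (hS (S.starProjection_apply_mem x))) fun i =>
      (S.sub_starProjection_mem_orthogonal x) _
        (Submodule.le_topologicalClosure _ (Submodule.subset_span ⟨i, rfl⟩))
  rw [sub_eq_zero.1 h1]
  exact S.starProjection_apply_mem x

/-- If the n-th vector vanishes, so does the n-th residual fibre, and the n vectors with indices
below n span. If it does not vanish, neither do the earlier ones, because the residual fibres
decrease; this gives n+1 independent vectors. -/
theorem frame_eq_zero_iff (V : HilbertField H) (n : ℕ) (t : unitInterval) :
    V.frame n t = 0 ↔ Cardinal.toENat (Module.rank ℂ (V.fiber t)) ≤ n := by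
  constructor
  · intro h
    have h1 : (V.residual n).fiber t = ⊥ := ((V.residual n).pick_spec n).2.2 t h
    classical
    set F : Finset H := (Finset.range n).image fun i => V.frame i t
    have h2 : V.fiber t ≤ Submodule.span ℂ (F : Set H) := by
      intro x hx
      set S := Submodule.span ℂ (F : Set H)
      have hS : S ≤ V.fiber t := Submodule.span_le.2 (by
        intro y hy
        obtain ⟨i, -, rfl⟩ := Finset.mem_image.1 (Finset.mem_coe.1 hy)
        exact V.frame_mem i t)
      have : FiniteDimensional ℂ S := FiniteDimensional.span_finset ℂ F
      have h3 := V.mem_residual_of_inner t (x := x - S.starProjection x)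
        ((V.fiber t).sub_mem hx (hS (S.starProjection_apply_mem x))) n fun i hi =>
          (S.sub_starProjection_mem_orthogonal x) _ (Submodule.subset_span
            (Finset.mem_coe.2 (Finset.mem_image_of_mem _ (Finset.mem_range.2 hi))))
      rw [h1, Submodule.mem_bot] at h3
      rw [sub_eq_zero.1 h3]
      exact S.starProjection_apply_mem x
    have h3 : Module.rank ℂ (V.fiber t) ≤ n := by
      refine (Submodule.rank_mono h2).trans ((rank_span_finset_le F).trans ?_)
      exact_mod_cast Finset.card_image_le.trans (Finset.card_range n).le
    simpa using (Cardinal.toENat_le_natCast).2 h3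
  · intro h
    by_contra h0
    have h1 : ∀ i : Fin (n + 1), V.frame i t ≠ 0 := by
      intro i hi
      apply h0
      have h2 : (V.residual i).fiber t = ⊥ := ((V.residual i).pick_spec i).2.2 t hi
      have h3 := V.fiber_residual_antitone t (Nat.lt_succ_iff.1 i.2) (V.frame_mem_residual n t)
      change V.frame n t ∈ (V.residual i).fiber t at h3
      rwa [h2, Submodule.mem_bot] at h3
    have h2 : LinearIndependent ℂ fun i : Fin (n + 1) => (⟨V.frame i t, V.frame_mem i t⟩ : V.fiber t) := by
      refine linearIndependent_of_ne_zero_of_inner_eq_zero (𝕜 := ℂ) (fun i hi => h1 i ?_) fun i j hij => ?_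
      · exact congrArg Subtype.val hi
      · exact V.inner_frame t (by simpa [Fin.ext_iff] using hij)
    have h3 := h2.cardinal_lift_le_rank
    have h4 : ((n + 1 : ℕ) : Cardinal) ≤ Module.rank ℂ (V.fiber t) := by simpa using h3
    rw [Cardinal.toENat_le_natCast] at h
    have := h4.trans h
    norm_cast at this
    omega

end HilbertField

end

section

/-! ### Compact operators and partial isometries -/

section Operators

variable {H : Type*} [NormedAddCommGroup H] [InnerProductSpace ℂ H]

theorem continuous_rankOne : Continuous fun p : H × H => (rankOne ℂ p.1 p.2 : H →L[ℂ] H) :=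
  (ContinuousLinearMap.smulRightL ℂ H H).continuous₂.comp
    (((innerSL ℂ).continuous.comp continuous_snd).prodMk continuous_fst)

theorem rankOne_mem_closure_span {S : Set H} {x y : H}
    (hx : x ∈ (Submodule.span ℂ S).topologicalClosure)
    (hy : y ∈ (Submodule.span ℂ S).topologicalClosure) :
    rankOne ℂ x y ∈ (Submodule.span ℂ
      {R : H →L[ℂ] H | ∃ x ∈ S, ∃ y ∈ S, R = rankOne ℂ x y}).topologicalClosure := by
  refine map_mem_closure₂ (f := fun x y => (rankOne ℂ x y : H →L[ℂ] H)) continuous_rankOne hx hy fun x hx y hy => ?_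
  have h1 : ∀ y ∈ S, rankOne ℂ x y ∈ Submodule.span ℂ
      {R : H →L[ℂ] H | ∃ x ∈ S, ∃ y ∈ S, R = rankOne ℂ x y} := fun y hy => by
    induction hx using Submodule.span_induction with
    | mem x hx => exact Submodule.subset_span ⟨x, hx, y, hy, rfl⟩
    | zero => simp
    | add x x' _ _ h h' => simpa using add_mem h h'
    | smul c x _ h => simpa using Submodule.smul_mem _ c h
  induction hy using Submodule.span_induction with
  | mem y hy => exact h1 y hy
  | zero => simp
  | add x x' _ _ h h' => simpa using add_mem h h'
  | smul c x _ h => simpa using Submodule.smul_mem _ (starRingEnd ℂ c) h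

variable [CompleteSpace H]

theorem comp_rankOne_comp (a b : H →L[ℂ] H) (x y : H) :
    a * rankOne ℂ x y * star b = rankOne ℂ (a x) (b y) := by
  ext1 z
  simp [ContinuousLinearMap.star_eq_adjoint, ContinuousLinearMap.adjoint_inner_right]

/-- A compact operator whose range and corange lie in the closed span of `S` is a limit of linear
combinations of rank-one operators with vectors in `S`. -/
theorem mem_closure_span_rankOne {S : Set H} {T : H →L[ℂ] H} (hT : IsCompactOperator T)
    (h1 : ∀ x, T x ∈ (Submodule.span ℂ S).topologicalClosure)
    (h2 : ∀ x, star T x ∈ (Submodule.span ℂ S).topologicalClosure) :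
    T ∈ (Submodule.span ℂ
      {R : H →L[ℂ] H | ∃ x ∈ S, ∃ y ∈ S, R = rankOne ℂ x y}).topologicalClosure := by
  set M := (Submodule.span ℂ
      {R : H →L[ℂ] H | ∃ x ∈ S, ∃ y ∈ S, R = rankOne ℂ x y}).topologicalClosure
  have hM : IsClosed (M : Set (H →L[ℂ] H)) := Submodule.isClosed_topologicalClosure _
  change T ∈ (M : Set (H →L[ℂ] H))
  rw [← hM.closure_eq, Metric.mem_closure_iff]
  intro ε hε
  have htb : TotallyBounded (T '' Metric.closedBall 0 1) :=
    (hT.isCompact_closure_image_closedBall (𝕜₁ := ℂ) (f := T.toLinearMap)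
      1).totallyBounded.subset subset_closure
  -- With W the span of a finite ε/2-net of the image of the unit ball, the approximant is P_W T = ∑
  -- b_i ⊗ T*b_i. For y in the net, Tx - P_W Tx is the projection of Tx - y on the complement of W.
  obtain ⟨t, hts, htf, ht⟩ := Metric.finite_approx_of_totallyBounded htb (ε / 2) (by positivity)
  set W := Submodule.span ℂ t
  have : FiniteDimensional ℂ W := FiniteDimensional.span_of_finite ℂ htf
  let b := stdOrthonormalBasis ℂ W
  have hWV : W ≤ (Submodule.span ℂ S).topologicalClosure := Submodule.span_le.2 fun y hy => by
    obtain ⟨x, -, rfl⟩ := hts hy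
    exact h1 x
  refine ⟨∑ i, rankOne ℂ (b i : H) (star T (b i)), sum_mem fun i _ =>
    rankOne_mem_closure_span (hWV (b i).2) (h2 _), ?_⟩
  have hP : ∀ x, (∑ i, rankOne ℂ (b i : H) (star T (b i))) x = W.starProjection (T x) := fun x => by
    rw [b.starProjection_eq_sum_rankOne]
    simp [ContinuousLinearMap.star_eq_adjoint, ContinuousLinearMap.adjoint_inner_left]
  rw [dist_eq_norm]
  refine lt_of_le_of_lt (ContinuousLinearMap.opNorm_le_of_unit_norm (by positivity)
    fun x hx => ?_) (half_lt_self hε)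
  rw [sub_apply, hP]
  obtain ⟨y, hy, hxy⟩ := mem_iUnion₂.1 (ht ⟨x, by simp [hx], rfl⟩)
  rw [Metric.mem_ball, dist_eq_norm] at hxy
  refine le_trans ?_ hxy.le
  have h3 : T x - W.starProjection (T x) = Wᗮ.starProjection (T x - y) := by
    rw [Submodule.starProjection_orthogonal_val, map_sub,
      Submodule.starProjection_eq_self_iff.2 (Submodule.subset_span hy : y ∈ W)]
    abel
  rw [h3]
  exact Submodule.norm_starProjection_apply_le _ _

/-- Two sequences with the same Gram matrix are related by a partial isometry. -/
theorem exists_partialIsometry (ξ ξ' : ℕ → H)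
    (h : ∀ i j, inner ℂ (ξ i) (ξ j) = inner ℂ (ξ' i) (ξ' j)) :
    ∃ u : H →L[ℂ] H, (∀ i, u (ξ i) = ξ' i) ∧
      (∀ x, u x ∈ (Submodule.span ℂ (range ξ')).topologicalClosure) ∧
      (∀ x, star u x ∈ (Submodule.span ℂ (range ξ)).topologicalClosure) ∧
      (∀ x ∈ (Submodule.span ℂ (range ξ)).topologicalClosure, star u (u x) = x) ∧
      (∀ x ∈ (Submodule.span ℂ (range ξ')).topologicalClosure, u (star u x) = x) ∧ ‖u‖ ≤ 1 := by
  set V := (Submodule.span ℂ (range ξ)).topologicalClosure with hV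
  set V' := (Submodule.span ℂ (range ξ')).topologicalClosure with hV'
  have : CompleteSpace V := (Submodule.isClosed_topologicalClosure _).completeSpace_coe
  have : CompleteSpace V' := (Submodule.isClosed_topologicalClosure _).completeSpace_coe
  -- Finitely supported coefficients map densely into each closed span. Equal Gram matrices make the
  -- two images of a coefficient vector equal in norm, even if the sequences are linearly dependent.
  have key : ∀ (η : ℕ → H), ∃ e : (ℕ →₀ ℂ) →ₗ[ℂ] (Submodule.span ℂ (range η)).topologicalClosure,
      DenseRange e ∧ ∀ c, (e c : H) = Finsupp.linearCombination ℂ η c := by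
    intro η
    have hc : ∀ c, Finsupp.linearCombination ℂ η c ∈ (Submodule.span ℂ (range η)).topologicalClosure :=
      fun c => Submodule.le_topologicalClosure _ (by
        rw [← Finsupp.range_linearCombination]; exact ⟨c, rfl⟩)
    refine ⟨(Finsupp.linearCombination ℂ η).codRestrict _ hc, ?_, fun c => rfl⟩
    rintro ⟨x, hx⟩
    rw [closure_subtype]
    rw [← Submodule.mem_toAddSubgroup, ← SetLike.mem_coe] at hx
    refine closure_mono ?_ hx
    intro y hy
    change y ∈ Submodule.span ℂ (range η) at hy
    rw [← Finsupp.range_linearCombination] at hy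
    obtain ⟨c, rfl⟩ := hy
    exact ⟨_, ⟨c, rfl⟩, rfl⟩
  obtain ⟨e, he, hec⟩ := key ξ
  obtain ⟨e', he', hec'⟩ := key ξ'
  have hn : ∀ c, ‖e' (LinearEquiv.refl ℂ _ c)‖ = ‖e c‖ := by
    intro c
    have h1 : inner ℂ (e' c : H) (e' c : H) = inner ℂ (e c : H) (e c : H) := by
      rw [hec, hec', Finsupp.linearCombination_apply, Finsupp.linearCombination_apply]
      simp only [Finsupp.sum, sum_inner, inner_sum, inner_smul_left, inner_smul_right, h]
    rw [inner_self_eq_norm_sq_to_K, inner_self_eq_norm_sq_to_K] at h1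
    have h2 : ‖(e' c : H)‖ ^ 2 = ‖(e c : H)‖ ^ 2 := by exact_mod_cast h1
    exact (pow_left_inj₀ (norm_nonneg _) (norm_nonneg _) two_ne_zero).1 h2
  let U : V ≃ₗᵢ[ℂ] V' := LinearEquiv.extendOfIsometry (LinearEquiv.refl ℂ _) e e' he he' hn
  have hU : ∀ c, U (e c) = e' c := LinearEquiv.extendOfIsometry_eq _ _ _ he he' hn
  set u : H →L[ℂ] H := V'.subtypeL ∘L (U : V →L[ℂ] V') ∘L V.orthogonalProjectionOnto with hu
  have hu' : star u = V.subtypeL ∘L (U.symm : V' →L[ℂ] V) ∘L V'.orthogonalProjectionOnto := by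
    rw [ContinuousLinearMap.star_eq_adjoint, eq_comm, ContinuousLinearMap.eq_adjoint_iff]
    intro x y
    simp only [hu, ContinuousLinearMap.comp_apply, Submodule.subtypeL_apply]
    rw [← Submodule.inner_orthogonalProjectionOnto_eq_of_mem_left,
      ← Submodule.inner_orthogonalProjectionOnto_eq_of_mem_right]
    exact U.symm.inner_map_eq_flip _ _
  refine ⟨u, fun i => ?_, fun x => ?_, fun x => ?_, fun x hx => ?_, fun x hx => ?_, ?_⟩
  · have h1 : ξ i = (e (Finsupp.single i 1) : H) := by simp [hec]
    have h2 : ξ' i = (e' (Finsupp.single i 1) : H) := by simp [hec']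
    rw [h1, h2, ← hU, hu]
    simp
  · exact (U (V.orthogonalProjectionOnto x)).2
  · rw [hu']
    exact (U.symm (V'.orthogonalProjectionOnto x)).2
  · lift x to V using hx
    rw [hu']
    simp [hu]
  · lift x to V' using hx
    rw [hu']
    simp [hu]
  · refine ContinuousLinearMap.opNorm_le_bound _ zero_le_one fun x => ?_
    have h1 : ‖u x‖ = ‖V.orthogonalProjectionOnto x‖ := U.norm_map _
    rw [h1, one_mul]
    exact V.norm_orthogonalProjectionOnto_apply_le x

end Operators

/-! ### Evaluation on the algebra `C([0,1], 𝕂)` -/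

namespace StableInterval

/-- Evaluation at a point of the interval. -/
def eval (t : unitInterval) : StableInterval →⋆ₙₐ[ℂ] (Hilb →L[ℂ] Hilb) where
  toFun d := ((show C(unitInterval, compactOps) from d) t : Hilb →L[ℂ] Hilb)
  map_smul' _ _ := rfl
  map_zero' := rfl
  map_add' _ _ := rfl
  map_mul' _ _ := rfl
  map_star' _ := rfl

theorem ext_eval {c d : StableInterval} (h : ∀ t, eval t c = eval t d) : c = d :=
  ContinuousMap.ext fun t => Subtype.ext (h t)

theorem continuous_eval (d : StableInterval) : Continuous fun t => eval t d :=
  continuous_subtype_val.comp (show C(unitInterval, compactOps) from d).continuous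

theorem isCompactOperator_eval (d : StableInterval) (t : unitInterval) :
    IsCompactOperator (eval t d) :=
  ((show C(unitInterval, compactOps) from d) t).2

theorem norm_eval_le (d : StableInterval) (t : unitInterval) : ‖eval t d‖ ≤ ‖d‖ :=
  ContinuousMap.norm_coe_le_norm (show C(unitInterval, compactOps) from d) t

theorem norm_le {d : StableInterval} {C : ℝ} (hC : 0 ≤ C) (h : ∀ t, ‖eval t d‖ ≤ C) : ‖d‖ ≤ C :=
  (ContinuousMap.norm_le (show C(unitInterval, compactOps) from d) hC).2 h

theorem continuous_eval_left (t : unitInterval) : Continuous (eval t) :=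
  AddMonoidHomClass.continuous_of_bound (eval t) 1 fun d => by simpa using norm_eval_le d t

/-- The element of `C([0,1], 𝕂)` given by a continuous function. -/
def ofFun (F : unitInterval → Hilb →L[ℂ] Hilb) (hF : Continuous F)
    (hK : ∀ t, IsCompactOperator (F t)) : StableInterval :=
  (⟨fun t => ⟨F t, hK t⟩, hF.subtype_mk _⟩ : C(unitInterval, compactOps))

end StableInterval

end

section

/-! ### Hereditary subalgebras of `C([0,1], 𝕂)` -/

open StableInterval

instance separableSpace_hilb : TopologicalSpace.SeparableSpace Hilb := by
  have h : (Submodule.span ℂ (range fun i : ℕ => lp.single (E := fun _ : ℕ => ℂ) 2 i (1 : ℂ))).topologicalClosure = ⊤ := by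
    rw [eq_top_iff]
    intro f _
    have h1 := lp.hasSum_single (E := fun _ : ℕ => ℂ) (p := 2) (by simp) f
    refine mem_closure_of_tendsto h1 (Eventually.of_forall fun s => ?_)
    refine sum_mem fun i _ => ?_
    have h2 : lp.single (E := fun _ : ℕ => ℂ) 2 i (f i) = f i • lp.single (E := fun _ : ℕ => ℂ) 2 i (1 : ℂ) := by
      rw [← lp.single_smul]; simp
    rw [h2]
    exact Submodule.smul_mem _ _ (Submodule.subset_span ⟨i, rfl⟩)
  have h2 : TopologicalSpace.IsSeparable (univ : Set Hilb) := by
    have h3 := ((countable_range fun i : ℕ => lp.single (E := fun _ : ℕ => ℂ) 2 i (1 : ℂ)).isSeparable.span (R := ℂ)).closure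
    rw [← Submodule.topologicalClosure_coe, h] at h3
    simpa using h3
  exact TopologicalSpace.isSeparable_univ_iff.1 h2

namespace StableInterval

/-- The product of an element of `C([0,1], 𝕂)` with a continuous function. -/
def funSMul (g : C(unitInterval, ℂ)) (d : StableInterval) : StableInterval :=
  ofFun (fun t => g t • eval t d) (g.continuous.smul (continuous_eval d))
    fun t => (isCompactOperator_eval d t).smul (g t)

@[simp]
theorem eval_funSMul (g : C(unitInterval, ℂ)) (d : StableInterval) (t : unitInterval) :
    eval t (funSMul g d) = g t • eval t d := rfl

theorem isCompactOperator_rankOne (x y : Hilb) : IsCompactOperator (rankOne ℂ x y : Hilb →L[ℂ] Hilb) := by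
  have h : IsCompactOperator (ContinuousLinearMap.toSpanSingleton ℂ x : ℂ →L[ℂ] Hilb) :=
    isCompactOperator_of_locallyCompactSpace_rng _
  exact h.comp_clm (innerSL ℂ y)

/-- The constant function with value a compact operator. -/
def const (T : Hilb →L[ℂ] Hilb) (hT : IsCompactOperator T) : StableInterval :=
  ofFun (fun _ => T) continuous_const fun _ => hT

@[simp]
theorem eval_const (T : Hilb →L[ℂ] Hilb) (hT : IsCompactOperator T) (t : unitInterval) :
    eval t (const T hT) = T := rfl

end StableInterval

variable {A : NonUnitalStarSubalgebra ℂ StableInterval}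

/-- a*(c*c)a ≤ ‖c*c‖ a*a, and the right side is in `A`. -/
theorem IsHereditary.star_mul_mul_self_mem (hA : IsHereditary A) {a : StableInterval} (ha : a ∈ A)
    (c : StableInterval) : star a * (star c * c) * a ∈ A := by
  let _ := CStarAlgebra.spectralOrder StableInterval
  have _ := CStarAlgebra.spectralOrderedRing StableInterval
  have h1 : (‖star c * c‖ : ℝ) • (star a * a) ∈ A := by
    have := A.smul_mem' (‖star c * c‖ : ℂ) (mul_mem (star_mem ha) ha)
    exact this
  refine hA.mem_of_le _ h1 _ ⟨c * a, by simp [mul_assoc]⟩ ?_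
  exact CStarAlgebra.nonneg_iff_eq_star_mul_self.1 (sub_nonneg.2
    (CStarAlgebra.star_left_conjugate_le_norm_smul (IsSelfAdjoint.star_mul_self c)))

theorem polarization {D : Type*} [NonUnitalRing D] [StarRing D] [Module ℂ D] [IsScalarTower ℂ D D]
    [SMulCommClass ℂ D D] [StarModule ℂ D] (a d b : D) :
    (4 : ℂ) • (star a * d * b) = star (a + b) * d * (a + b) - star (a - b) * d * (a - b)
      - Complex.I • (star (a + Complex.I • b) * d * (a + Complex.I • b))
      + Complex.I • (star (a - Complex.I • b) * d * (a - Complex.I • b)) := by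
  simp only [star_add, star_sub, star_smul, Complex.star_def, Complex.conj_I, add_mul, mul_add, sub_mul, mul_sub,
    smul_mul_assoc, mul_smul_comm, smul_add, smul_sub, smul_smul, neg_smul, neg_mul, smul_neg, Complex.I_mul_I]
  module

/-- Positive elements span the whole algebra, and for positive d polarization reduces to the
diagonal case a = b. -/
theorem IsHereditary.star_mul_mul_mem (hA : IsHereditary A) {a b : StableInterval} (ha : a ∈ A)
    (hb : b ∈ A) (d : StableInterval) : star a * d * b ∈ A := by
  let _ := CStarAlgebra.spectralOrder StableInterval
  have _ := CStarAlgebra.spectralOrderedRing StableInterval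
  have hd : d ∈ Submodule.span ℂ {d : StableInterval | 0 ≤ d} := by
    rw [CStarAlgebra.span_nonneg]; trivial
  induction hd using Submodule.span_induction with
  | mem d hd =>
    obtain ⟨c, rfl⟩ := CStarAlgebra.nonneg_iff_eq_star_mul_self.1 (show 0 ≤ d from hd)
    have h1 := polarization a (star c * c) b
    have hIb : Complex.I • b ∈ A := A.smul_mem' _ hb
    have h2 : star a * (star c * c) * b = (1 / 4 : ℂ) • ((4 : ℂ) • (star a * (star c * c) * b)) := by
      rw [smul_smul]; norm_num
    rw [h2]
    refine A.smul_mem' _ ?_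
    change (4 : ℂ) • (star a * (star c * c) * b) ∈ A
    rw [h1]
    exact add_mem (sub_mem (sub_mem (hA.star_mul_mul_self_mem (add_mem ha hb) c)
      (hA.star_mul_mul_self_mem (sub_mem ha hb) c))
      (A.smul_mem' _ (hA.star_mul_mul_self_mem (add_mem ha hIb) c)))
      (A.smul_mem' _ (hA.star_mul_mul_self_mem (sub_mem ha hIb) c))
  | zero => simp
  | add x y _ _ hx hy => rw [mul_add, add_mul]; exact add_mem hx hy
  | smul r x _ hx => rw [mul_smul_comm, smul_mul_assoc]; exact A.smul_mem' _ hx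

theorem IsHereditary.mul_mul_mem (hA : IsHereditary A) {a b : StableInterval} (ha : a ∈ A)
    (hb : b ∈ A) (d : StableInterval) : a * d * b ∈ A := by
  simpa using hA.star_mul_mul_mem (star_mem ha) hb d

theorem IsHereditary.exists_approximateUnit (hA : IsHereditary A) :
    ∃ l : Filter StableInterval, l.NeBot ∧ (∀ᶠ e in l, e ∈ A ∧ ‖e‖ ≤ 1) ∧
      ∀ m ∈ A, Tendsto (fun e => e * m) l (𝓝 m) := by
  have : IsClosed (A : Set StableInterval) := hA.isClosed
  let _ := CStarAlgebra.spectralOrder A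
  have _ := CStarAlgebra.spectralOrderedRing A
  have hl := CStarAlgebra.increasingApproximateUnit A
  refine ⟨(CStarAlgebra.approximateUnit A).map (fun e : A => (e : StableInterval)), inferInstance, ?_, ?_⟩
  · rw [eventually_map]
    filter_upwards [hl.eventually_norm] with e he
    exact ⟨e.2, he⟩
  · intro m hm
    rw [tendsto_map'_iff]
    exact (continuous_subtype_val.tendsto _).comp (hl.tendsto_mul_right ⟨m, hm⟩)

/-! ### Essential subspaces and recovery of the subalgebra from them -/

/-- The vectors `a(t) x`, with `a` in the subalgebra. -/
def rangeVectors (A : NonUnitalStarSubalgebra ℂ StableInterval) (t : unitInterval) : Set Hilb :=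
  {y | ∃ a ∈ A, ∃ x, eval t a x = y}

/-- The essential subspace of the fibre of a subalgebra at a point. -/
def essSpace (A : NonUnitalStarSubalgebra ℂ StableInterval) (t : unitInterval) : Submodule ℂ Hilb :=
  (Submodule.span ℂ (rangeVectors A t)).topologicalClosure

theorem isClosed_essSpace (A : NonUnitalStarSubalgebra ℂ StableInterval) (t : unitInterval) :
    IsClosed (essSpace A t : Set Hilb) := Submodule.isClosed_topologicalClosure _

instance completeSpace_essSpace (A : NonUnitalStarSubalgebra ℂ StableInterval) (t : unitInterval) :
    CompleteSpace (essSpace A t) := (isClosed_essSpace A t).completeSpace_coe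

theorem eval_apply_mem {a : StableInterval} (ha : a ∈ A) (t : unitInterval) (x : Hilb) :
    eval t a x ∈ essSpace A t :=
  Submodule.le_topologicalClosure _ (Submodule.subset_span ⟨a, ha, x, rfl⟩)

theorem star_eval_apply_mem {a : StableInterval} (ha : a ∈ A) (t : unitInterval) (x : Hilb) :
    star (eval t a) x ∈ essSpace A t := by
  rw [← map_star]
  exact eval_apply_mem (star_mem ha) t x

/-- If x = a(t)x₀ and y = b(t)y₀, then a(x₀ ⊗ y₀)b* has the required value at t, and it lies in `A`
by heredity. -/
theorem IsHereditary.exists_eval_eq_rankOne (hA : IsHereditary A) {t : unitInterval} {x y : Hilb}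
    (hx : x ∈ rangeVectors A t) (hy : y ∈ rangeVectors A t) :
    ∃ c ∈ A, eval t c = rankOne ℂ x y := by
  obtain ⟨a, ha, x, rfl⟩ := hx
  obtain ⟨b, hb, y, rfl⟩ := hy
  refine ⟨a * const _ (isCompactOperator_rankOne x y) * star b, hA.mul_mul_mem ha (star_mem hb) _, ?_⟩
  rw [map_mul, map_mul, map_star, eval_const, comp_rankOne_comp]

/-- Every compact operator on the essential subspace is approximated by values of elements of any
subspace attaining the rank-one operators. -/
theorem exists_eval_near_of_rankOne {t : unitInterval} (N : Submodule ℂ StableInterval)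
    (hN : ∀ x ∈ rangeVectors A t, ∀ y ∈ rangeVectors A t, ∃ c ∈ N, eval t c = rankOne ℂ x y)
    {T : Hilb →L[ℂ] Hilb} (hT : IsCompactOperator T) (h1 : ∀ x, T x ∈ essSpace A t)
    (h2 : ∀ x, star T x ∈ essSpace A t) {ε : ℝ} (hε : 0 < ε) : ∃ c ∈ N, ‖T - eval t c‖ < ε := by
  have h3 := mem_closure_span_rankOne hT h1 h2
  obtain ⟨R, hR, hd⟩ := Metric.mem_closure_iff.1 h3 ε hε
  have h4 : Submodule.span ℂ {R : Hilb →L[ℂ] Hilb | ∃ x ∈ rangeVectors A t, ∃ y ∈ rangeVectors A t,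
      R = rankOne ℂ x y} ≤ N.map (eval t : StableInterval →ₗ[ℂ] (Hilb →L[ℂ] Hilb)) := by
    refine Submodule.span_le.2 ?_
    rintro _ ⟨x, hx, y, hy, rfl⟩
    obtain ⟨c, hc, h⟩ := hN x hx y hy
    exact ⟨c, hc, h⟩
  obtain ⟨c, hc, rfl⟩ := h4 hR
  exact ⟨c, hc, by rw [← dist_eq_norm]; exact hd⟩

theorem IsHereditary.exists_eval_near (hA : IsHereditary A) {t : unitInterval} {T : Hilb →L[ℂ] Hilb}
    (hT : IsCompactOperator T) (h1 : ∀ x, T x ∈ essSpace A t) (h2 : ∀ x, star T x ∈ essSpace A t)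
    {ε : ℝ} (hε : 0 < ε) : ∃ c ∈ A, ‖T - eval t c‖ < ε :=
  exists_eval_near_of_rankOne A.toSubmodule (fun _ hx _ hy => hA.exists_eval_eq_rankOne hx hy)
    hT h1 h2 hε

/-- Near each t, d is within ε/6 of some c ∈ `A`, on which e acts almost as a unit; compactness of
the interval makes the estimate uniform. Membership of d in `A` is not assumed, which is what
`mem_of_eval` needs. -/
theorem IsHereditary.tendsto_mul (hA : IsHereditary A) {l : Filter StableInterval}
    (hl : ∀ᶠ e in l, e ∈ A ∧ ‖e‖ ≤ 1) (hm : ∀ m ∈ A, Tendsto (fun e => e * m) l (𝓝 m))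
    {d : StableInterval} (h1 : ∀ t x, eval t d x ∈ essSpace A t)
    (h2 : ∀ t x, star (eval t d) x ∈ essSpace A t) : Tendsto (fun e => e * d) l (𝓝 d) := by
  rw [Metric.tendsto_nhds]
  intro ε hε
  have key : ∀ᶠ e in l, ∀ t ∈ (univ : Set unitInterval), ‖eval t (e * d - d)‖ ≤ ε / 2 := by
    refine isCompact_univ.induction_on (p := fun S : Set unitInterval =>
      ∀ᶠ e in l, ∀ t ∈ S, ‖eval t (e * d - d)‖ ≤ ε / 2) (by simp) (fun S T hST h => ?_)
      (fun S T hS hT => ?_) fun t _ => ?_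
    · filter_upwards [h] with e he t ht using he t (hST ht)
    · filter_upwards [hS, hT] with e he he' t ht using ht.elim (he t) (he' t)
    · obtain ⟨c, hc, hct⟩ := hA.exists_eval_near (isCompactOperator_eval d t) (h1 t) (h2 t)
        (show 0 < ε / 6 by positivity)
      have h3 : ∀ᶠ s in 𝓝 t, ‖eval s d - eval s c‖ < ε / 6 :=
        (((continuous_eval d).sub (continuous_eval c)).norm.tendsto t).eventually_lt_const hct
      refine ⟨_, mem_nhdsWithin_of_mem_nhds h3, ?_⟩
      filter_upwards [hl, Metric.tendsto_nhds.1 (hm c hc) (ε / 6) (by positivity)] with e he hec s hs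
      have hs : ‖eval s d - eval s c‖ < ε / 6 := hs
      have h4 : eval s (e * d - d) = eval s e * (eval s d - eval s c) + eval s (e * c - c)
          - (eval s d - eval s c) := by
        simp only [map_sub, map_mul, mul_sub]; abel
      have h5 := norm_eval_le (e * c - c) s
      rw [← dist_eq_norm] at h5
      have h6 : ‖eval s e * (eval s d - eval s c)‖ ≤ 1 * (ε / 6) :=
        (norm_mul_le _ _).trans (mul_le_mul ((norm_eval_le e s).trans he.2) hs.le (norm_nonneg _) zero_le_one)
      rw [h4]
      calc _ ≤ _ := norm_sub_le _ _
        _ ≤ _ := add_le_add (norm_add_le _ _) le_rfl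
        _ ≤ ε / 2 := by linarith
  filter_upwards [key] with e he
  rw [dist_eq_norm]
  exact (norm_le (by positivity) fun t => he t trivial).trans_lt (half_lt_self hε)

/-- A hereditary subalgebra is determined by its essential subspaces. -/
theorem IsHereditary.mem_of_eval (hA : IsHereditary A) {d : StableInterval}
    (h1 : ∀ t x, eval t d x ∈ essSpace A t) (h2 : ∀ t x, star (eval t d) x ∈ essSpace A t) :
    d ∈ A := by
  obtain ⟨l, _, hl, hm⟩ := hA.exists_approximateUnit
  have h3 := hA.tendsto_mul hl hm h1 h2
  have h4 : Tendsto (fun e => e * star d) l (𝓝 (star d)) := by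
    refine hA.tendsto_mul hl hm (fun t x => ?_) fun t x => ?_
    · rw [map_star]; exact h2 t x
    · rw [map_star, star_star]; exact h1 t x
  have h5 : Tendsto (fun e => d * star e) l (𝓝 d) := by
    have := h4.star
    simpa using this
  have h6 : Tendsto (fun e => e * d * star e) l (𝓝 d) := by
    -- e d e* - d = e(d e* - d) + (e d - d), and e d e* belongs to `A`.
    have h7 : Tendsto (fun e => e * (d * star e - d)) l (𝓝 0) := by
      refine squeeze_zero_norm' (a := fun e => ‖d * star e - d‖) ?_ ?_
      · filter_upwards [hl] with e he
        exact (norm_mul_le _ _).trans (mul_le_of_le_one_left (norm_nonneg _) he.2)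
      · simpa using (h5.sub_const d).norm
    have h8 := h7.add h3
    rw [zero_add] at h8
    refine h8.congr fun e => ?_
    rw [mul_sub, mul_assoc]; abel
  refine hA.isClosed.mem_of_tendsto h6 ?_
  filter_upwards [hl] with e he
  exact hA.mul_mul_mem he.1 (star_mem he.1) d

theorem IsHereditary.funSMul_mem (hA : IsHereditary A) (g : C(unitInterval, ℂ)) {a : StableInterval}
    (ha : a ∈ A) : funSMul g a ∈ A := by
  refine hA.mem_of_eval (fun t x => ?_) fun t x => ?_
  · exact (essSpace A t).smul_mem _ (eval_apply_mem ha t x)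
  · rw [eval_funSMul, star_smul]
    exact (essSpace A t).smul_mem _ (star_eval_apply_mem ha t x)

/-- The essential subspaces of a subalgebra form a continuous field of Hilbert spaces. -/
theorem exists_hilbertField (A : NonUnitalStarSubalgebra ℂ StableInterval) :
    ∃ V : HilbertField Hilb, V.fiber = essSpace A := by
  let E : Submodule ℂ C(unitInterval, Hilb) :=
    { carrier := {ξ | ∀ t, ξ t ∈ essSpace A t}
      add_mem' := fun h h' t => (essSpace A t).add_mem (h t) (h' t)
      zero_mem' := fun t => (essSpace A t).zero_mem
      smul_mem' := fun c _ h t => (essSpace A t).smul_mem c (h t) }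
  -- Separability of ℓ² makes the space of sections separable. Sections r ↦ a(r)y already attain all
  -- range vectors at t, so a dense sequence of sections is dense in the fibre.
  let s := TopologicalSpace.denseSeq E
  refine ⟨⟨essSpace A, isClosed_essSpace A, fun k => s k, fun k t => (s k).2 t, fun t x hx => ?_⟩, rfl⟩
  have hev : Continuous fun ξ : E => (ξ : C(unitInterval, Hilb)) t :=
    (continuous_eval_const t).comp continuous_subtype_val
  have h1 : (Submodule.span ℂ (rangeVectors A t) : Set Hilb)
      ⊆ range fun ξ : E => (ξ : C(unitInterval, Hilb)) t := by
    let evl : E →ₗ[ℂ] Hilb :=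
      { toFun := fun ξ => (ξ : C(unitInterval, Hilb)) t, map_add' := fun _ _ => rfl, map_smul' := fun _ _ => rfl }
    change Submodule.span ℂ (rangeVectors A t) ≤ LinearMap.range evl
    refine Submodule.span_le.2 ?_
    rintro _ ⟨a, ha, y, rfl⟩
    exact ⟨⟨⟨fun r => eval r a y, (continuous_eval a).clm_apply continuous_const⟩,
      fun r => eval_apply_mem ha r y⟩, rfl⟩
  have h2 : range (fun ξ : E => (ξ : C(unitInterval, Hilb)) t)
      ⊆ closure (range fun k => (s k : C(unitInterval, Hilb)) t) := by
    have := hev.range_subset_closure_image_dense (TopologicalSpace.denseRange_denseSeq E)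
    rwa [← range_comp] at this
  exact closure_minimal (h1.trans h2) isClosed_closure hx

end

section

open StableInterval

/-! ### The spectrum of a full hereditary subalgebra -/

section IrrRep

variable {A : Type*} [NonUnitalRing A] [Module ℂ A] [Star A]

/-- Nonzero vectors are cyclic for irreducible representations. -/
theorem IrrRep.denseRange_orbit (π : IrrRep A) [IsScalarTower ℂ A A] {y : π.space} (hy : y ≠ 0) :
    DenseRange fun a => π.toHom a y := by
  let orb : A →ₗ[ℂ] π.space :=
    { toFun := fun a => π.toHom a y
      map_add' := fun a b => by simp
      map_smul' := fun c a => by simp }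
  have hinv : ∀ a, ∀ w ∈ (LinearMap.range orb).topologicalClosure,
      π.toHom a w ∈ (LinearMap.range orb).topologicalClosure := by
    intro a w hw
    refine map_mem_closure (π.toHom a).continuous hw ?_
    rintro _ ⟨b, rfl⟩
    exact ⟨a * b, by simp [orb]⟩
  rcases π.irreducible _ (Submodule.isClosed_topologicalClosure _) hinv with h | h
  · exfalso
    have h0 : ∀ a, π.toHom a y = 0 := fun a => by
      have : π.toHom a y ∈ (LinearMap.range orb).topologicalClosure :=
        Submodule.le_topologicalClosure _ ⟨a, rfl⟩
      rwa [h, Submodule.mem_bot] at this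
    let N : Submodule ℂ π.space := ⨅ a, LinearMap.ker (π.toHom a).toLinearMap
    have hN : ∀ z, z ∈ N ↔ ∀ a, π.toHom a z = 0 := fun z => by simp [N]
    have hNc : IsClosed (N : Set π.space) := by
      have : (N : Set π.space) = ⋂ a, {z | π.toHom a z = 0} := by ext z; simp [hN]
      rw [this]
      exact isClosed_iInter fun a => isClosed_eq (π.toHom a).continuous continuous_const
    rcases π.irreducible N hNc (fun a w hw => by rw [(hN w).1 hw a]; exact N.zero_mem) with h1 | h1
    · have : y ∈ N := (hN y).2 h0
      rw [h1, Submodule.mem_bot] at this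
      exact hy this
    · obtain ⟨a, ha⟩ := π.nonzero
      refine ha (ContinuousLinearMap.ext fun z => (hN z).1 (h1 ▸ Submodule.mem_top) a)
  · intro z
    have : z ∈ (LinearMap.range orb).topologicalClosure := h ▸ Submodule.mem_top
    exact this

/-- The kernel of an irreducible representation is prime. -/
theorem IrrRep.exists_mul_mul_ne_zero (π : IrrRep A) [IsScalarTower ℂ A A] {a b : A}
    (ha : π.toHom a ≠ 0) (hb : π.toHom b ≠ 0) : ∃ c, π.toHom (a * c * b) ≠ 0 := by
  by_contra! h
  obtain ⟨x, hx⟩ : ∃ x, π.toHom b x ≠ 0 := by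
    by_contra! hx
    exact hb (ContinuousLinearMap.ext hx)
  refine ha (ContinuousLinearMap.coeFn_injective ((π.denseRange_orbit hx).equalizer
    (π.toHom a).continuous continuous_const (funext fun c => ?_)))
  simpa using congrArg (fun T => T x) (h c)

/-- Irreducible representations with vectors that induce the same seminorm are equivalent. -/
theorem IrrRep.equivalent_of_norm_eq [IsScalarTower ℂ A A] {ρ π : IrrRep A} {v : ρ.space}
    {w : π.space} (hv : v ≠ 0) (hw : w ≠ 0) (h : ∀ a, ‖π.toHom a w‖ = ‖ρ.toHom a v‖) :
    ρ.Equivalent π := by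
  let e₁ : A →ₗ[ℂ] ρ.space :=
    { toFun := fun a => ρ.toHom a v
      map_add' := fun a b => by rw [map_add]; rfl
      map_smul' := fun c a => by rw [map_smul]; rfl }
  let e₂ : A →ₗ[ℂ] π.space :=
    { toFun := fun a => π.toHom a w
      map_add' := fun a b => by rw [map_add]; rfl
      map_smul' := fun c a => by rw [map_smul]; rfl }
  have hd₁ : DenseRange e₁ := ρ.denseRange_orbit hv
  have hd₂ : DenseRange e₂ := π.denseRange_orbit hw
  let U : ρ.space ≃ₗᵢ[ℂ] π.space :=
    LinearEquiv.extendOfIsometry (LinearEquiv.refl ℂ A) e₁ e₂ hd₁ hd₂ h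
  have hU : ∀ a, U (e₁ a) = e₂ a := LinearEquiv.extendOfIsometry_eq _ _ _ hd₁ hd₂ h
  refine ⟨U, fun a x => ?_⟩
  have hc₁ : Continuous fun x => U (ρ.toHom a x) := U.continuous.comp (ρ.toHom a).continuous
  have hc₂ : Continuous fun x => π.toHom a (U x) := (π.toHom a).continuous.comp U.continuous
  refine congrFun (hd₁.equalizer hc₁ hc₂ (funext fun b => ?_)) x
  have h1 : ρ.toHom a (e₁ b) = e₁ (a * b) := by
    change _ = ρ.toHom (a * b) _
    rw [map_mul]; rfl
  have h2 : π.toHom a (e₂ b) = e₂ (a * b) := by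
    change _ = π.toHom (a * b) _
    rw [map_mul]; rfl
  simp only [Function.comp_apply]
  rw [h1, hU, hU, h2]

end IrrRep

variable {A : NonUnitalStarSubalgebra ℂ StableInterval}

/-- The restriction of the value of an element of a subalgebra to the essential subspace. -/
def fiberOp (t : unitInterval) (a : A) : essSpace A t →L[ℂ] essSpace A t :=
  ((eval t (a : StableInterval)).comp (essSpace A t).subtypeL).codRestrict (essSpace A t)
    fun x => eval_apply_mem a.2 t x

@[simp]
theorem coe_fiberOp_apply (t : unitInterval) (a : A) (x : essSpace A t) :
    (fiberOp t a x : Hilb) = eval t (a : StableInterval) x := rfl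

variable (A) in
/-- The action of a subalgebra on its essential subspace at a point. -/
def fiberHom (t : unitInterval) : A →⋆ₙₐ[ℂ] (essSpace A t →L[ℂ] essSpace A t) where
  toFun := fiberOp t
  map_smul' c a := ContinuousLinearMap.ext fun x => Subtype.ext (by simp)
  map_zero' := ContinuousLinearMap.ext fun x => Subtype.ext (by simp)
  map_add' a b := ContinuousLinearMap.ext fun x => Subtype.ext (by simp)
  map_mul' a b := ContinuousLinearMap.ext fun x => Subtype.ext (by simp)
  map_star' a := by
    rw [ContinuousLinearMap.star_eq_adjoint, ContinuousLinearMap.eq_adjoint_iff]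
    intro x y
    change inner ℂ (eval t (star (a : StableInterval)) x) (y : Hilb)
      = inner ℂ (x : Hilb) (eval t (a : StableInterval) y)
    rw [map_star, ContinuousLinearMap.star_eq_adjoint, ContinuousLinearMap.adjoint_inner_left]

@[simp]
theorem coe_fiberHom_apply (t : unitInterval) (a : A) (x : essSpace A t) :
    (fiberHom A t a x : Hilb) = eval t (a : StableInterval) x := rfl

/-- The vectors a(t)*x lie in the essential subspace, so a(t)a(t)* = 0. -/
theorem eval_eq_zero_of_fiberHom {t : unitInterval} {a : A} (h : fiberHom A t a = 0) :
    eval t (a : StableInterval) = 0 := by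
  have h1 : eval t (a : StableInterval) * star (eval t (a : StableInterval)) = 0 := by
    ext1 x
    exact congrArg Subtype.val (congrArg (fun T => T ⟨_, star_eval_apply_mem a.2 t x⟩) h)
  exact CStarRing.mul_star_self_eq_zero_iff _ |>.1 h1

theorem exists_rangeVectors_ne_zero {t : unitInterval} (ht : essSpace A t ≠ ⊥) :
    ∃ v ∈ rangeVectors A t, ‖v‖ = 1 := by
  by_contra! h
  apply ht
  have h0 : ∀ v ∈ rangeVectors A t, v = 0 := by
    rintro _ ⟨a, ha, x, rfl⟩
    by_contra h0
    refine h ((‖eval t a x‖⁻¹ : ℂ) • eval t a x) ⟨a, ha, (‖eval t a x‖⁻¹ : ℂ) • x, map_smul _ _ _⟩ ?_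
    rw [norm_smul]
    have := norm_ne_zero_iff.2 h0
    simp [this]
  rw [eq_bot_iff, essSpace]
  refine Submodule.topologicalClosure_minimal _ (Submodule.span_le.2 fun v hv => ?_) ?_
  · exact h0 v hv
  · simp

/-- Otherwise the kernel of evaluation at t would be a proper closed ideal containing `A`. -/
theorem IsFull.essSpace_ne_bot (hA : IsFull A) (t : unitInterval) : essSpace A t ≠ ⊥ := by
  intro h
  have h1 := hA (TwoSidedIdeal.ker (eval t)) ?_ ?_
  · let x : Hilb := lp.single 2 0 (1 : ℂ)
    have hx : x ≠ 0 := by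
      rw [← norm_pos_iff, lp.norm_single (by simp)]
      simp
    have h2 : const _ (isCompactOperator_rankOne x x) ∈ TwoSidedIdeal.ker (eval t) := h1 ▸ trivial
    rw [TwoSidedIdeal.mem_ker, eval_const] at h2
    simp [hx] at h2
  · have : (TwoSidedIdeal.ker (eval t) : Set StableInterval) = eval t ⁻¹' {0} := by
      ext d; simp [TwoSidedIdeal.mem_ker]
    rw [this]
    exact isClosed_singleton.preimage (continuous_eval_left t)
  · intro a ha
    rw [TwoSidedIdeal.mem_ker]
    ext1 x
    have := eval_apply_mem ha t x
    rw [h, Submodule.mem_bot] at this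
    simpa using this

/-- The irreducible representation of a hereditary subalgebra at a point of the interval. -/
def fiberRep (hA : IsHereditary A) (t : unitInterval) (ht : essSpace A t ≠ ⊥) : IrrRep A where
  space := essSpace A t
  toHom := fiberHom A t
  nonzero := by
    obtain ⟨v, hv, hv1⟩ := exists_rangeVectors_ne_zero ht
    obtain ⟨c, hc, h⟩ := hA.exists_eval_eq_rankOne hv hv
    refine ⟨⟨c, hc⟩, fun h0 => ?_⟩
    have h1 := eval_eq_zero_of_fiberHom h0
    rw [h] at h1
    have := congrArg norm h1
    simp [hv1] at this
  irreducible := by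
    intro W hW hinv
    refine or_iff_not_imp_left.2 fun hne => ?_
    obtain ⟨w, hw, hw0⟩ := (Submodule.ne_bot_iff _).1 hne
    obtain ⟨y, hy, hyw⟩ : ∃ y ∈ rangeVectors A t, inner ℂ y (w : Hilb) ≠ 0 := by
      by_contra! h
      apply hw0
      have h1 : essSpace A t ≤ (ℂ ∙ (w : Hilb))ᗮ :=
        Submodule.topologicalClosure_minimal _ (Submodule.span_le.2 fun y hy =>
          Submodule.mem_orthogonal_singleton_iff_inner_left.2 (h y hy)) (Submodule.isClosed_orthogonal _)
      have h2 := Submodule.mem_orthogonal_singleton_iff_inner_left.1 (h1 w.2)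
      exact Subtype.ext (inner_self_eq_zero.1 h2)
    have hWm : IsClosed ((W.map (essSpace A t).subtype : Submodule ℂ Hilb) : Set Hilb) := by
      exact (isClosed_essSpace A t).isClosedEmbedding_subtypeVal.isClosedMap _ hW
    have h2 : essSpace A t ≤ W.map (essSpace A t).subtype := by
      refine Submodule.topologicalClosure_minimal _ (Submodule.span_le.2 fun x hx => ?_) hWm
      -- The operator x ⊗ y sends w to ⟨y, w⟩x with ⟨y, w⟩ ≠ 0, so an invariant subspace containing
      -- w contains every range vector x.
      obtain ⟨c, hc, h⟩ := hA.exists_eval_eq_rankOne hx hy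
      refine ⟨(inner ℂ y (w : Hilb))⁻¹ • fiberHom A t ⟨c, hc⟩ w, W.smul_mem _ (hinv _ w hw), ?_⟩
      simp [h, smul_smul, hyw]
    rw [eq_top_iff]
    intro x _
    obtain ⟨x', hx', h⟩ := h2 x.2
    rwa [← Subtype.ext h]

/-! ### Irreducible representations are supported at one point -/

theorem norm_toHom_le (hA : IsHereditary A) (π : IrrRep A) (a : A) :
    ‖π.toHom a‖ ≤ ‖(a : StableInterval)‖ := by
  have : IsClosed (A : Set StableInterval) := hA.isClosed
  exact NonUnitalStarAlgHom.norm_apply_le π.toHom a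

/-- An irreducible representation factors through evaluation at some point. -/
theorem IsHereditary.exists_factor (hA : IsHereditary A) (π : IrrRep A) :
    ∃ t, ∀ a : A, eval t (a : StableInterval) = 0 → π.toHom a = 0 := by
  by_contra! h
  -- If no point works, each t has a neighbourhood on which some element outside ker π vanishes.
  -- Primeness handles unions through products a c b, so compactness produces an element vanishing
  -- everywhere but not killed by π.
  have key : ∃ a : A, π.toHom a ≠ 0 ∧ ∀ s ∈ (univ : Set unitInterval), eval s (a : StableInterval) = 0 := by
    refine isCompact_univ.induction_on (p := fun S : Set unitInterval =>
      ∃ a : A, π.toHom a ≠ 0 ∧ ∀ s ∈ S, eval s (a : StableInterval) = 0) ?_ ?_ ?_ ?_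
    · obtain ⟨a, ha⟩ := π.nonzero
      exact ⟨a, ha, by simp⟩
    · rintro S T hST ⟨a, ha, h0⟩
      exact ⟨a, ha, fun s hs => h0 s (hST hs)⟩
    · rintro S T ⟨a, ha, h0⟩ ⟨b, hb, h0'⟩
      obtain ⟨c, hc⟩ := π.exists_mul_mul_ne_zero ha hb
      refine ⟨_, hc, fun s hs => ?_⟩
      rcases hs with hs | hs
      · simp [h0 s hs]
      · simp [h0' s hs]
    · intro t _
      obtain ⟨a, hat, ha⟩ := h t
      set δ : ℝ := ‖π.toHom a‖ / 2
      have hδ : 0 < δ := half_pos (norm_pos_iff.2 ha)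
      have hm : ∀ s, max ‖eval s (a : StableInterval)‖ δ ≠ 0 := fun s => (lt_max_of_lt_right hδ).ne'
      -- g vanishes where ‖a(s)‖ ≤ δ, while ‖a - ga‖ ≤ δ < ‖π(a)‖; hence π(ga) ≠ 0.
      let g : C(unitInterval, ℂ) :=
        ⟨fun s => ((1 - δ / max ‖eval s (a : StableInterval)‖ δ : ℝ) : ℂ), by
          have hc := (continuous_eval (a : StableInterval)).norm
          exact Complex.continuous_ofReal.comp (continuous_const.sub
            (continuous_const.div (hc.max continuous_const) hm))⟩
      refine ⟨{s | ‖eval s (a : StableInterval)‖ < δ}, mem_nhdsWithin_of_mem_nhds ?_,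
        ⟨_, hA.funSMul_mem g a.2⟩, fun h0 => ?_, fun s hs => ?_⟩
      · refine (isOpen_lt (continuous_eval (a : StableInterval)).norm continuous_const).mem_nhds ?_
        simpa [hat] using hδ
      · have h1 := norm_toHom_le hA π (a - ⟨_, hA.funSMul_mem g a.2⟩)
        rw [map_sub, h0, sub_zero] at h1
        have h2 : ‖((a - ⟨_, hA.funSMul_mem g a.2⟩ : A) : StableInterval)‖ ≤ δ := by
          refine norm_le hδ.le fun s => ?_
          have h3 : eval s ((a - ⟨_, hA.funSMul_mem g a.2⟩ : A) : StableInterval)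
              = ((δ / max ‖eval s (a : StableInterval)‖ δ : ℝ) : ℂ) • eval s (a : StableInterval) := by
            change eval s ((a : StableInterval) - funSMul g a) = _
            rw [map_sub, eval_funSMul]
            change _ - (((1 - δ / max ‖eval s (a : StableInterval)‖ δ : ℝ) : ℂ)) • _ = _
            rw [Complex.ofReal_sub, sub_smul, Complex.ofReal_one, one_smul, sub_sub_cancel]
          rw [h3, norm_smul, Complex.norm_real, Real.norm_of_nonneg (by positivity), div_mul_eq_mul_div,
            div_le_iff₀ (lt_max_of_lt_right hδ)]
          gcongr
          exact le_max_left _ _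
        have h4 : ‖π.toHom a‖ = 2 * δ := by simp only [δ]; ring
        linarith
      · have h1 : max ‖eval s (a : StableInterval)‖ δ = δ := max_eq_right (le_of_lt hs)
        change ((1 - δ / max ‖eval s (a : StableInterval)‖ δ : ℝ) : ℂ) • eval s (a : StableInterval) = 0
        rw [h1, div_self hδ.ne', sub_self, Complex.ofReal_zero, zero_smul]
  obtain ⟨a, ha, h0⟩ := key
  have : a = 0 := Subtype.ext (ext_eval fun t => by simpa using h0 t trivial)
  rw [this, map_zero] at ha
  exact ha rfl

/-- Multiplying a by a scalar function equal to 1 at t leaves π(a) unchanged and brings the global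
norm down to ‖a(t)‖ + δ. -/
theorem IsHereditary.norm_toHom_le_eval (hA : IsHereditary A) {π : IrrRep A} {t : unitInterval}
    (hπ : ∀ a : A, eval t (a : StableInterval) = 0 → π.toHom a = 0) (a : A) :
    ‖π.toHom a‖ ≤ ‖eval t (a : StableInterval)‖ := by
  refine le_of_forall_pos_le_add fun δ hδ => ?_
  set C := ‖eval t (a : StableInterval)‖ + δ with hC
  have hC0 : 0 < C := by positivity
  have hm : ∀ s, max ‖eval s (a : StableInterval)‖ C ≠ 0 := fun s => (lt_max_of_lt_right hC0).ne'
  let g : C(unitInterval, ℂ) :=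
    ⟨fun s => ((C / max ‖eval s (a : StableInterval)‖ C : ℝ) : ℂ), by
      have hc := (continuous_eval (a : StableInterval)).norm
      exact Complex.continuous_ofReal.comp (continuous_const.div (hc.max continuous_const) hm)⟩
  have hgt : g t = 1 := by
    have : max ‖eval t (a : StableInterval)‖ C = C := max_eq_right (by linarith)
    change ((C / max ‖eval t (a : StableInterval)‖ C : ℝ) : ℂ) = 1
    rw [this, div_self hC0.ne', Complex.ofReal_one]
  have h1 : π.toHom a = π.toHom ⟨_, hA.funSMul_mem g a.2⟩ := by
    rw [← sub_eq_zero, ← map_sub]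
    apply hπ
    change eval t ((a : StableInterval) - funSMul g a) = 0
    rw [map_sub, eval_funSMul, hgt, one_smul, sub_self]
  rw [h1]
  refine (norm_toHom_le hA π _).trans (norm_le hC0.le fun s => ?_)
  change ‖((C / max ‖eval s (a : StableInterval)‖ C : ℝ) : ℂ) • eval s (a : StableInterval)‖ ≤ C
  rw [norm_smul, Complex.norm_real, Real.norm_of_nonneg (by positivity), div_mul_eq_mul_div,
    div_le_iff₀ (lt_max_of_lt_right hC0)]
  gcongr
  exact le_max_left _ _

theorem toHom_congr {π : IrrRep A} {t : unitInterval}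
    (hπ : ∀ a : A, eval t (a : StableInterval) = 0 → π.toHom a = 0) {a b : A}
    (h : eval t (a : StableInterval) = eval t (b : StableInterval)) : π.toHom a = π.toHom b := by
  rw [← sub_eq_zero, ← map_sub]
  apply hπ
  change eval t ((a : StableInterval) - b) = 0
  rw [map_sub, h, sub_self]

theorem rankOne_mul_rankOne_mul_rankOne {v : Hilb} (hv : ‖v‖ = 1) (x y : Hilb) :
    (rankOne ℂ x v * rankOne ℂ v v * rankOne ℂ v y : Hilb →L[ℂ] Hilb) = rankOne ℂ x y := by
  ext1 z
  simp [hv]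

/-- Since x ⊗ y = (x ⊗ v)(v ⊗ v)(v ⊗ y), π(e) = 0 would make every such rank-one operator a value at
t of an element of ker π. These values are dense enough to approximate a(t) for every a,
contradicting π ≠ 0. -/
theorem IsHereditary.toHom_ne_zero_of_rankOne (hA : IsHereditary A) {π : IrrRep A} {t : unitInterval}
    (hπ : ∀ a : A, eval t (a : StableInterval) = 0 → π.toHom a = 0) {v : Hilb}
    (hv : v ∈ rangeVectors A t) (hv1 : ‖v‖ = 1) {e : A}
    (hev : eval t (e : StableInterval) = rankOne ℂ v v) : π.toHom e ≠ 0 := by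
  intro h0
  let N : Submodule ℂ StableInterval :=
    (LinearMap.ker (π.toHom : A →ₗ[ℂ] (π.space →L[ℂ] π.space))).map A.toSubmodule.subtype
  have hN : ∀ x ∈ rangeVectors A t, ∀ y ∈ rangeVectors A t, ∃ c ∈ N, eval t c = rankOne ℂ x y := by
    intro x hx y hy
    obtain ⟨c₁, hc₁, h₁⟩ := hA.exists_eval_eq_rankOne hx hv
    obtain ⟨c₂, hc₂, h₂⟩ := hA.exists_eval_eq_rankOne hv hy
    refine ⟨_, ⟨(⟨c₁, hc₁⟩ * e * ⟨c₂, hc₂⟩ : A), ?_, rfl⟩, ?_⟩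
    · change π.toHom _ = 0
      rw [map_mul, map_mul, h0, mul_zero, zero_mul]
    · change eval t (c₁ * (e : StableInterval) * c₂) = _
      rw [map_mul, map_mul, h₁, hev, h₂, rankOne_mul_rankOne_mul_rankOne hv1]
  obtain ⟨a, ha⟩ := π.nonzero
  obtain ⟨_, ⟨c, hc, rfl⟩, hd⟩ := exists_eval_near_of_rankOne N hN
    (isCompactOperator_eval (a : StableInterval) t) (eval_apply_mem a.2 t)
    (star_eval_apply_mem a.2 t) (norm_pos_iff.2 ha)
  have h1 := hA.norm_toHom_le_eval hπ (a - c)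
  have hc0 : π.toHom c = 0 := hc
  rw [map_sub, hc0, sub_zero] at h1
  have h2 : eval t ((a - c : A) : StableInterval)
      = eval t (a : StableInterval) - eval t (A.toSubmodule.subtype c) := map_sub _ _ _
  rw [h2] at h1
  exact absurd hd (not_lt.2 h1)

/-- At t, (ae)*(ae) equals ‖a(t)v‖² e, and π sees only values at t; pairing with the fixed unit
vector w gives the equality of norms. -/
theorem norm_toHom_eq_of_rankOne {π : IrrRep A} {t : unitInterval}
    (hπ : ∀ a : A, eval t (a : StableInterval) = 0 → π.toHom a = 0) {v : Hilb} {e : A}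
    (hev : eval t (e : StableInterval) = rankOne ℂ v v) {w : π.space} (hw1 : ‖w‖ = 1)
    (hew : π.toHom e w = w) (a : A) : ‖π.toHom a w‖ = ‖eval t (a : StableInterval) v‖ := by
  set x : A := a * e with hx
  have h1 : π.toHom a w = π.toHom x w := by
    rw [hx, map_mul, mul_apply_eq_comp, hew]
  have h2 : π.toHom (star x * x)
      = ((‖eval t (a : StableInterval) v‖ ^ 2 : ℝ) : ℂ) • π.toHom e := by
    rw [← map_smul]
    refine toHom_congr hπ ?_
    change eval t (star ((a : StableInterval) * (e : StableInterval)) * ((a : StableInterval) * (e : StableInterval))) = eval t (_ • (e : StableInterval))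
    rw [map_smul, map_mul, map_star, map_mul, hev, ContinuousLinearMap.mul_def _ (rankOne ℂ v v),
      comp_rankOne]
    ext1 y
    rw [mul_apply_eq_comp]
    refine ext_inner_left ℂ fun y' => ?_
    rw [ContinuousLinearMap.star_eq_adjoint, ContinuousLinearMap.adjoint_inner_right]
    simp [inner_smul_left, inner_smul_right, inner_self_eq_norm_sq_to_K]
    ring
  have h3 : (inner ℂ (π.toHom x w) (π.toHom x w) : ℂ)
      = ((‖eval t (a : StableInterval) v‖ ^ 2 : ℝ) : ℂ) := by
    have h4 : π.toHom (star x * x) w = star (π.toHom x) (π.toHom x w) := by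
      rw [map_mul, map_star]; rfl
    rw [← ContinuousLinearMap.adjoint_inner_right, ← ContinuousLinearMap.star_eq_adjoint, ← h4, h2,
      smul_apply, hew, inner_smul_right, inner_self_eq_norm_sq_to_K, hw1]
    simp
  rw [h1]
  rw [inner_self_eq_norm_sq_to_K] at h3
  have h5 : ‖π.toHom x w‖ ^ 2 = ‖eval t (a : StableInterval) v‖ ^ 2 := by
    simpa using congrArg norm h3
  exact (sq_eq_sq₀ (norm_nonneg _) (norm_nonneg _)).1 h5

/-- An irreducible representation that factors through evaluation at `t` is equivalent to the
representation on the essential subspace at `t`. -/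
theorem IsHereditary.fiberRep_equivalent (hA : IsHereditary A) {π : IrrRep A} {t : unitInterval}
    (ht : essSpace A t ≠ ⊥)
    (hπ : ∀ a : A, eval t (a : StableInterval) = 0 → π.toHom a = 0) :
    (fiberRep hA t ht).Equivalent π := by
  obtain ⟨v, hv, hv1⟩ := exists_rangeVectors_ne_zero ht
  obtain ⟨e, he, hev⟩ := hA.exists_eval_eq_rankOne hv hv
  have hvV : v ∈ essSpace A t := Submodule.le_topologicalClosure _ (Submodule.subset_span hv)
  have hπe : π.toHom ⟨e, he⟩ ≠ 0 := hA.toHom_ne_zero_of_rankOne hπ hv hv1 hev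
  obtain ⟨z, hz⟩ : ∃ z, π.toHom ⟨e, he⟩ z ≠ 0 := by
    by_contra! hx
    exact hπe (ContinuousLinearMap.ext hx)
  set w : π.space := (‖π.toHom ⟨e, he⟩ z‖⁻¹ : ℂ) • π.toHom ⟨e, he⟩ z with hw
  have hw1 : ‖w‖ = 1 := by
    rw [hw, norm_smul]
    have := norm_ne_zero_iff.2 hz
    simp [this]
  have hew : π.toHom ⟨e, he⟩ w = w := by
    have h1 : π.toHom (⟨e, he⟩ * ⟨e, he⟩) = π.toHom ⟨e, he⟩ := toHom_congr hπ (by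
      change eval t (e * e) = eval t e
      rw [map_mul, hev]
      ext1 x
      simp [hv1])
    rw [hw, map_smul]
    congr 1
    rw [map_mul] at h1
    exact congrArg (fun T => T z) h1
  have hv0 : (⟨v, hvV⟩ : essSpace A t) ≠ 0 := by
    intro h
    rw [show v = 0 from congrArg Subtype.val h, norm_zero] at hv1
    exact zero_ne_one hv1
  have hw0 : w ≠ 0 := by
    intro h
    rw [h, norm_zero] at hw1
    exact zero_ne_one hw1
  exact IrrRep.equivalent_of_norm_eq (ρ := fiberRep hA t ht) hv0 hw0
    fun a => norm_toHom_eq_of_rankOne hπ (e := ⟨e, he⟩) hev hw1 hew a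

/-! ### The spectrum as a copy of the interval -/

/-- The canonical map from the interval to the spectrum of a full hereditary subalgebra. -/
def fiberPoint (hA : IsHereditary A) (hA' : IsFull A) (t : unitInterval) : Spectrum A :=
  (fiberRep hA t (hA'.essSpace_ne_bot t)).toSpectrum

theorem fiberPoint_surjective (hA : IsHereditary A) (hA' : IsFull A) :
    Function.Surjective (fiberPoint hA hA') := by
  intro σ
  induction σ using Quotient.inductionOn with
  | h π =>
    obtain ⟨t, ht⟩ := hA.exists_factor π
    exact ⟨t, Quotient.sound (hA.fiberRep_equivalent (hA'.essSpace_ne_bot t) ht)⟩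

theorem mem_kernel_fiberPoint (hA : IsHereditary A) (hA' : IsFull A) (t : unitInterval) (a : A) :
    a ∈ (fiberPoint hA hA' t).kernel ↔ eval t (a : StableInterval) = 0 := by
  refine ⟨fun h => eval_eq_zero_of_fiberHom h, fun h => ?_⟩
  change fiberHom A t a = 0
  ext x
  simp [h]

theorem exists_eval_ne_zero (hA' : IsFull A) (t : unitInterval) : ∃ a ∈ A, eval t a ≠ 0 := by
  obtain ⟨_, ⟨a, ha, x, rfl⟩, hv⟩ := exists_rangeVectors_ne_zero (hA'.essSpace_ne_bot t)
  refine ⟨a, ha, fun h => ?_⟩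
  simp [h] at hv

/-- The open subset of the spectrum that corresponds to an open subset of the interval. -/
theorem isOpen_fiberPoint (hA : IsHereditary A) (hA' : IsFull A) {O : Set unitInterval}
    (hO : IsOpen O) : ∃ S : Set (Spectrum A), IsOpen S ∧ ∀ t, fiberPoint hA hA' t ∈ S ↔ t ∈ O := by
  let J : TwoSidedIdeal A := TwoSidedIdeal.mk' {a : A | ∀ s ∉ O, eval s (a : StableInterval) = 0}
    (fun s _ => by simp) (fun {a b} ha hb s hs => by simp [ha s hs, hb s hs])
    (fun {a} ha s hs => by simp [ha s hs]) (fun {a b} hb s hs => by simp [hb s hs])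
    (fun {a b} ha s hs => by simp [ha s hs])
  have hJ : ∀ a, a ∈ J ↔ ∀ s ∉ O, eval s (a : StableInterval) = 0 := fun a => by
    simp [J, TwoSidedIdeal.mem_mk']
  refine ⟨_, TopologicalSpace.isOpen_generateFrom_of_mem ⟨J, rfl⟩, fun t => ⟨?_, fun ht => ?_⟩⟩
  · rintro ⟨a, haJ, ha⟩
    by_contra ht
    exact ha ((mem_kernel_fiberPoint hA hA' t a).2 ((hJ a).1 haJ t ht))
  · obtain ⟨a, ha, hat⟩ := exists_eval_ne_zero hA' t
    obtain ⟨g, hg0, hg1, -⟩ := exists_continuous_zero_one_of_isClosed hO.isClosed_compl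
      (isClosed_singleton (x := t)) (disjoint_singleton_right.2 (not_not.2 ht))
    let g' : C(unitInterval, ℂ) := ⟨fun s => (g s : ℂ), by fun_prop⟩
    refine ⟨⟨_, hA.funSMul_mem g' ha⟩, (hJ _).2 fun s hs => ?_, fun h => hat ?_⟩
    · have : g s = 0 := hg0 hs
      simp [g', this]
    · have h1 : g t = 1 := hg1 rfl
      have h2 := (mem_kernel_fiberPoint hA hA' t _).1 h
      simpa [g', h1] using h2

theorem fiberPoint_injective (hA : IsHereditary A) (hA' : IsFull A) :
    Function.Injective (fiberPoint hA hA') := by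
  intro t s h
  by_contra hts
  obtain ⟨S, -, hS⟩ := isOpen_fiberPoint hA hA' (isOpen_compl_singleton (x := s))
  have h1 := (hS t).2 hts
  rw [h, hS s] at h1
  exact h1 rfl

/-- Any identification of the spectrum with the interval differs from the canonical one by a
homeomorphism of the interval. -/
theorem exists_homeomorph_fiberPoint (hA : IsHereditary A) (hA' : IsFull A)
    (α : unitInterval ≃ₜ Spectrum A) :
    ∃ g : unitInterval ≃ₜ unitInterval, ∀ t, α t = fiberPoint hA hA' (g t) := by
  let c : unitInterval ≃ Spectrum A :=
    Equiv.ofBijective _ ⟨fiberPoint_injective hA hA', fiberPoint_surjective hA hA'⟩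
  let g : unitInterval ≃ unitInterval := α.toEquiv.trans c.symm
  have hg : ∀ t, α t = fiberPoint hA hA' (g t) := fun t => (c.apply_symm_apply (α t)).symm
  -- One direction suffices: a continuous bijection from a compact space to a Hausdorff space is a
  -- homeomorphism.
  have hc : Continuous g := by
    refine continuous_def.2 fun O hO => ?_
    obtain ⟨S, hSo, hS⟩ := isOpen_fiberPoint hA hA' hO
    have : g ⁻¹' O = α ⁻¹' S := by
      ext t
      rw [mem_preimage, mem_preimage, hg, hS]
    rw [this]
    exact hSo.preimage α.continuous
  exact ⟨hc.homeoOfEquivCompactToT2, hg⟩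

end

section

open StableInterval

/-! ### Transport along a field of partial isometries -/

/-- Conjugation of a continuous compact-operator-valued function by partial isometries that carry
one frame to another is continuous. -/
theorem continuous_conj {X H : Type*} [TopologicalSpace X] [NormedAddCommGroup H]
    [InnerProductSpace ℂ H] [CompleteSpace H] {x y : ℕ → X → H} {u D : X → H →L[ℂ] H}
    (hD : Continuous D) (hK : ∀ s, IsCompactOperator (D s))
    (h1 : ∀ s v, D s v ∈ (Submodule.span ℂ (range fun n => x n s)).topologicalClosure)
    (h2 : ∀ s v, star (D s) v ∈ (Submodule.span ℂ (range fun n => x n s)).topologicalClosure)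
    (hx : ∀ n s, x n s ≠ 0 → ContinuousAt (x n) s) (hy : ∀ n s, x n s ≠ 0 → ContinuousAt (y n) s)
    (hxy : ∀ n s, u s (x n s) = y n s) (hu : ∀ s, ‖u s‖ ≤ 1) :
    Continuous fun s => u s * D s * star (u s) := by
  rw [continuous_iff_continuousAt]
  intro s₀
  have key : ∀ R ∈ Submodule.span ℂ {R : H →L[ℂ] H | ∃ v ∈ range (fun n => x n s₀),
      ∃ w ∈ range (fun n => x n s₀), R = rankOne ℂ v w}, ∃ M : X → H →L[ℂ] H, M s₀ = R ∧
      ContinuousAt M s₀ ∧ ContinuousAt (fun s => u s * M s * star (u s)) s₀ := by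
    intro R hR
    induction hR using Submodule.span_induction with
    | mem R hR =>
      obtain ⟨_, ⟨i, rfl⟩, _, ⟨j, rfl⟩, rfl⟩ := hR
      -- A frame vector may be discontinuous at a zero, but then the rank-one operator at s₀ is 0
      -- and the constant 0 extends it.
      by_cases hi : x i s₀ = 0
      · exact ⟨fun _ => 0, by simp [hi], continuousAt_const, by simpa using continuousAt_const⟩
      by_cases hj : x j s₀ = 0
      · exact ⟨fun _ => 0, by simp [hj], continuousAt_const, by simpa using continuousAt_const⟩
      refine ⟨fun s => rankOne ℂ (x i s) (x j s), rfl, ?_, ?_⟩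
      · exact ContinuousAt.comp (f := fun s => (x i s, x j s)) continuous_rankOne.continuousAt
          ((hx i s₀ hi).prodMk (hx j s₀ hj))
      · simp only [comp_rankOne_comp, hxy]
        exact ContinuousAt.comp (f := fun s => (y i s, y j s)) continuous_rankOne.continuousAt
          ((hy i s₀ hi).prodMk (hy j s₀ hj))
    | zero => exact ⟨fun _ => 0, rfl, continuousAt_const, by simpa using continuousAt_const⟩
    | add R R' _ _ h h' =>
      obtain ⟨M, h0, hc, hc'⟩ := h
      obtain ⟨M', h0', hd, hd'⟩ := h'
      exact ⟨fun s => M s + M' s, by simp [h0, h0'], hc.add hd, by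
        simp only [mul_add, add_mul]
        exact hc'.add hd'⟩
    | smul c R _ h =>
      obtain ⟨M, h0, hc, hc'⟩ := h
      exact ⟨fun s => c • M s, by simp [h0], hc.const_smul c, by
        simp only [mul_smul_comm, smul_mul_assoc]
        exact hc'.const_smul c⟩
  rw [ContinuousAt, Metric.tendsto_nhds]
  intro ε hε
  obtain ⟨R, hR, hd⟩ := Metric.mem_closure_iff.1 (mem_closure_span_rankOne (hK s₀) (h1 s₀) (h2 s₀))
    (ε / 3) (by positivity)
  obtain ⟨M, rfl, hM, hM'⟩ := key R hR
  rw [dist_eq_norm] at hd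
  -- Conjugation by contractions does not increase distances, so no continuity of u itself is
  -- needed.
  have hbound : ∀ s, ‖D s - M s‖ < ε / 3 →
      ‖u s * D s * star (u s) - u s * M s * star (u s)‖ < ε / 3 := fun s hs => by
    rw [← sub_mul, ← mul_sub]
    refine lt_of_le_of_lt ?_ hs
    refine (norm_mul_le _ _).trans ((mul_le_of_le_one_right (norm_nonneg _) ?_).trans
      ((norm_mul_le _ _).trans (mul_le_of_le_one_left (norm_nonneg _) (hu s))))
    rw [norm_star]
    exact hu s
  have h3 : ∀ᶠ s in 𝓝 s₀, ‖D s - M s‖ < ε / 3 :=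
    (hD.continuousAt.sub hM).norm.eventually_lt_const hd
  filter_upwards [h3, Metric.tendsto_nhds.1 hM' (ε / 3) (by positivity)] with s hs hs'
  have h4 := hbound s hs
  have h5 := hbound s₀ hd
  rw [← dist_eq_norm] at h4 h5
  rw [dist_comm] at h5
  calc dist (u s * D s * star (u s)) (u s₀ * D s₀ * star (u s₀))
      ≤ _ := dist_triangle4 _ (u s * M s * star (u s)) (u s₀ * M s₀ * star (u s₀)) _
    _ < ε := by linarith

theorem _root_.IsCompactOperator.conj {H : Type*} [NormedAddCommGroup H] [InnerProductSpace ℂ H]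
    [CompleteSpace H] {T : H →L[ℂ] H} (hT : IsCompactOperator T) (u : H →L[ℂ] H) :
    IsCompactOperator (u * T * star u : H →L[ℂ] H) :=
  (hT.clm_comp u).comp_clm (star u)

/-! ### Isomorphisms induced by fields of unitaries -/

variable {A B : NonUnitalStarSubalgebra ℂ StableInterval}

/-- A field of unitary operators from the essential subspaces of `A` to those of `B`, over a
homeomorphism of the interval. -/
structure FieldIso (A B : NonUnitalStarSubalgebra ℂ StableInterval)
    (k : unitInterval ≃ₜ unitInterval) (u : unitInterval → Hilb →L[ℂ] Hilb) : Prop where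
  mem : ∀ s x, u s x ∈ essSpace B s
  star_mem : ∀ s x, star (u s) x ∈ essSpace A (k s)
  star_apply : ∀ s, ∀ x ∈ essSpace A (k s), star (u s) (u s x) = x
  apply_star : ∀ s, ∀ x ∈ essSpace B s, u s (star (u s) x) = x
  continuous : ∀ a ∈ A, Continuous fun s => u s * eval (k s) a * star (u s)
  continuous_symm : ∀ b ∈ B, Continuous fun s => star (u s) * eval s b * u s

namespace FieldIso

variable {k : unitInterval ≃ₜ unitInterval} {u : unitInterval → Hilb →L[ℂ] Hilb}

theorem symm (h : FieldIso A B k u) : FieldIso B A k.symm fun t => star (u (k.symm t)) where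
  mem t x := by simpa using h.star_mem (k.symm t) x
  star_mem t x := by simpa using h.mem (k.symm t) x
  star_apply t x hx := by simpa using h.apply_star (k.symm t) x hx
  apply_star t x hx := by simpa using h.star_apply (k.symm t) x (by simpa using hx)
  continuous b hb := ((h.continuous_symm b hb).comp k.symm.continuous).congr fun t => by simp
  continuous_symm a ha := ((h.continuous a ha).comp k.symm.continuous).congr fun t => by simp

/-- Conjugation by a field of unitary operators, as a map between subalgebras. -/
def map (h : FieldIso A B k u) (hB : IsHereditary B) (a : A) : B :=
  ⟨ofFun (fun s => u s * eval (k s) (a : StableInterval) * star (u s)) (h.continuous a a.2) fun s =>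
      (isCompactOperator_eval (a : StableInterval) (k s)).conj (u s),
    hB.mem_of_eval (fun t x => h.mem t _) fun t x => by
      change star (u t * eval (k t) (a : StableInterval) * star (u t)) x ∈ _
      rw [star_mul, star_mul, star_star]
      exact h.mem t _⟩

theorem eval_map (h : FieldIso A B k u) (hB : IsHereditary B) (a : A) (s : unitInterval) :
    eval s (h.map hB a : StableInterval) = u s * eval (k s) (a : StableInterval) * star (u s) := rfl

theorem star_mul_mul_eval (h : FieldIso A B k u) {a : StableInterval} (ha : a ∈ A)
    (s : unitInterval) : star (u s) * (u s * eval (k s) a) = eval (k s) a :=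
  ContinuousLinearMap.ext fun x => h.star_apply s _ (eval_apply_mem ha _ x)

theorem eval_mul_star_mul (h : FieldIso A B k u) {a : StableInterval} (ha : a ∈ A)
    (s : unitInterval) : eval (k s) a * star (u s) * u s = eval (k s) a := by
  have h1 := congrArg star (h.star_mul_mul_eval (StarMemClass.star_mem ha) s)
  simpa [map_star, mul_assoc] using h1

theorem map_map (h : FieldIso A B k u) {k' : unitInterval ≃ₜ unitInterval}
    {u' : unitInterval → Hilb →L[ℂ] Hilb} (h' : FieldIso B A k' u') (hk : ∀ t, k (k' t) = t)
    (hu : ∀ t, u' t = star (u (k' t))) (hA : IsHereditary A) (hB : IsHereditary B) (a : A) :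
    h'.map hA (h.map hB a) = a := by
  refine Subtype.ext (ext_eval fun t => ?_)
  have h1 := h.star_mul_mul_eval a.2 (k' t)
  have h2 := h.eval_mul_star_mul a.2 (k' t)
  rw [hk] at h1 h2
  rw [eval_map, eval_map, hk, hu, star_star, ← mul_assoc, ← mul_assoc, mul_assoc _ _ (eval t _), h1, h2]

/-- The isomorphism of hereditary subalgebras given by a field of unitary operators. -/
def starAlgEquiv (h : FieldIso A B k u) (hA : IsHereditary A) (hB : IsHereditary B) :
    A ≃⋆ₐ[ℂ] B where
  toFun := h.map hB
  invFun := h.symm.map hA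
  left_inv a := h.map_map h.symm (by simp) (fun _ => rfl) hA hB a
  right_inv b := h.symm.map_map h (by simp) (by simp) hB hA b
  map_mul' a b := by
    refine Subtype.ext (ext_eval fun s => ?_)
    change u s * eval (k s) ((a : StableInterval) * b) * star (u s)
      = eval s ((h.map hB a : StableInterval) * h.map hB b)
    rw [map_mul, map_mul, eval_map, eval_map]
    ext1 x
    simp only [mul_apply_eq_comp]
    rw [h.star_apply s _ (eval_apply_mem b.2 _ _)]
  map_add' a b := by
    refine Subtype.ext (ext_eval fun s => ?_)
    change u s * eval (k s) ((a : StableInterval) + b) * star (u s)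
      = eval s ((h.map hB a : StableInterval) + h.map hB b)
    rw [map_add, map_add, eval_map, eval_map, mul_add, add_mul]
  map_star' a := by
    refine Subtype.ext (ext_eval fun s => ?_)
    change u s * eval (k s) (star (a : StableInterval)) * star (u s)
      = eval s (star (h.map hB a : StableInterval))
    rw [map_star, map_star, eval_map, star_mul, star_mul, star_star, mul_assoc]
  map_smul' c a := by
    refine Subtype.ext (ext_eval fun s => ?_)
    change u s * eval (k s) (c • (a : StableInterval)) * star (u s)
      = eval s (c • (h.map hB a : StableInterval))
    rw [map_smul, map_smul, eval_map, mul_smul_comm, smul_mul_assoc]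

theorem eval_starAlgEquiv (h : FieldIso A B k u) (hA : IsHereditary A) (hB : IsHereditary B) (a : A)
    (s : unitInterval) : eval s (h.starAlgEquiv hA hB a : StableInterval)
      = u s * eval (k s) (a : StableInterval) * star (u s) := rfl

/-- The pulled-back representation kills every a with a(k s) = 0, so it is the canonical one at k s.
-/
theorem comap_starAlgEquiv (h : FieldIso A B k u) (hA : IsHereditary A) (hA' : IsFull A)
    (hB : IsHereditary B) (hB' : IsFull B) (s : unitInterval) :
    Spectrum.comap (h.starAlgEquiv hA hB) (fiberPoint hB hB' s) = fiberPoint hA hA' (k s) := by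
  refine (Quotient.sound (hA.fiberRep_equivalent (hA'.essSpace_ne_bot (k s)) fun a ha => ?_)).symm
  change fiberHom B s (h.starAlgEquiv hA hB a) = 0
  ext1 x
  refine Subtype.ext ?_
  rw [coe_fiberHom_apply, eval_starAlgEquiv, ha]
  simp

end FieldIso

/-! ### Normalized frames -/

/-- The normalized frame of a field of Hilbert spaces. -/
def HilbertField.unitFrame {H : Type*} [NormedAddCommGroup H] [InnerProductSpace ℂ H]
    [CompleteSpace H] (V : HilbertField H) (n : ℕ) (t : unitInterval) : H :=
  -- At a zero of the frame vector this is 0, and continuity may fail there.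
  (‖V.frame n t‖⁻¹ : ℂ) • V.frame n t

namespace HilbertField

variable {H : Type*} [NormedAddCommGroup H] [InnerProductSpace ℂ H] [CompleteSpace H]

theorem unitFrame_eq_zero_iff (V : HilbertField H) (n : ℕ) (t : unitInterval) :
    V.unitFrame n t = 0 ↔ V.frame n t = 0 := by simp [unitFrame]

theorem continuousAt_unitFrame (V : HilbertField H) {n : ℕ} {t : unitInterval}
    (h : V.unitFrame n t ≠ 0) : ContinuousAt (V.unitFrame n) t := by
  have h0 : (‖V.frame n t‖ : ℂ) ≠ 0 := by simpa [unitFrame_eq_zero_iff] using h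
  have hc : ContinuousAt (fun t => (‖V.frame n t‖ : ℂ)) t :=
    (by fun_prop : Continuous fun t => (‖V.frame n t‖ : ℂ)).continuousAt
  exact (hc.inv₀ h0).smul (V.frame n).continuous.continuousAt

theorem inner_unitFrame_of_ne (V : HilbertField H) {i j : ℕ} (hij : i ≠ j) (t : unitInterval) :
    inner ℂ (V.unitFrame i t) (V.unitFrame j t) = 0 := by
  simp [unitFrame, V.inner_frame t hij]

theorem inner_unitFrame_self (V : HilbertField H) {i : ℕ} {t : unitInterval}
    (h : V.unitFrame i t ≠ 0) : inner ℂ (V.unitFrame i t) (V.unitFrame i t) = 1 := by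
  have h' : ‖V.frame i t‖ ≠ 0 := by simpa [unitFrame_eq_zero_iff] using h
  have h1 : ‖V.unitFrame i t‖ = 1 := by rw [unitFrame, norm_smul]; simp [h']
  rw [inner_self_eq_norm_sq_to_K, h1]
  simp

theorem closure_span_unitFrame (V : HilbertField H) (t : unitInterval) :
    (Submodule.span ℂ (range fun n => V.unitFrame n t)).topologicalClosure = V.fiber t := by
  refine le_antisymm (Submodule.topologicalClosure_minimal _ (Submodule.span_le.2 ?_)
    (V.isClosed_fiber t)) ((V.fiber_le_closure_span_frame t).trans
      (Submodule.topologicalClosure_mono (Submodule.span_le.2 ?_)))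
  · rintro _ ⟨n, rfl⟩
    exact (V.fiber t).smul_mem _ (V.frame_mem n t)
  · rintro _ ⟨n, rfl⟩
    by_cases h : V.frame n t = 0
    · simp [h]
    · have h1 : V.frame n t = (‖V.frame n t‖ : ℂ) • V.unitFrame n t := by
        rw [unitFrame, smul_smul, mul_inv_cancel₀ (by simpa using h), one_smul]
      change V.frame n t ∈ _
      rw [h1]
      exact Submodule.smul_mem _ _ (Submodule.subset_span ⟨n, rfl⟩)

end HilbertField

/-- Hereditary subalgebras whose essential subspaces have the same dimensions, up to a homeomorphism
of the interval, are related by a field of unitary operators. -/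
theorem exists_fieldIso (A B : NonUnitalStarSubalgebra ℂ StableInterval)
    (k : unitInterval ≃ₜ unitInterval)
    (hk : ∀ s, Cardinal.toENat (Module.rank ℂ (essSpace A (k s)))
      = Cardinal.toENat (Module.rank ℂ (essSpace B s))) : ∃ u, FieldIso A B k u := by
  obtain ⟨V, hV⟩ := exists_hilbertField A
  obtain ⟨W, hW⟩ := exists_hilbertField B
  have h0 : ∀ n s, V.frame n (k s) = 0 ↔ W.frame n s = 0 := fun n s => by
    rw [V.frame_eq_zero_iff, W.frame_eq_zero_iff, hV, hW, hk]
  have h0' : ∀ n s, V.unitFrame n (k s) = 0 ↔ W.unitFrame n s = 0 := fun n s => by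
    rw [V.unitFrame_eq_zero_iff, W.unitFrame_eq_zero_iff, h0]
  have hgram : ∀ s i j, (inner ℂ (V.unitFrame i (k s)) (V.unitFrame j (k s)) : ℂ)
      = inner ℂ (W.unitFrame i s) (W.unitFrame j s) := fun s i j => by
    rcases eq_or_ne i j with rfl | hij
    · by_cases h : V.unitFrame i (k s) = 0
      · rw [h, (h0' i s).1 h]
      · rw [V.inner_unitFrame_self h, W.inner_unitFrame_self (mt (h0' i s).2 h)]
    · rw [V.inner_unitFrame_of_ne hij, W.inner_unitFrame_of_ne hij]
  choose u hu hmem hmem' hl hr hn using fun s => exists_partialIsometry _ _ (hgram s)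
  simp only [HilbertField.closure_span_unitFrame, hV, hW] at hmem hmem' hl hr
  have hu' : ∀ s n, star (u s) (W.unitFrame n s) = V.unitFrame n (k s) := fun s n => by
    rw [← hu s n]
    refine hl s _ ?_
    rw [← hV, ← V.closure_span_unitFrame]
    exact Submodule.le_topologicalClosure _ (Submodule.subset_span ⟨n, rfl⟩)
  have hcV : ∀ n s, V.unitFrame n (k s) ≠ 0 → ContinuousAt (fun s => V.unitFrame n (k s)) s :=
    fun n s h => (V.continuousAt_unitFrame h).comp k.continuous.continuousAt
  refine ⟨u, hmem, hmem', hl, hr, fun a ha => ?_, fun b hb => ?_⟩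
  · refine continuous_conj (x := fun n s => V.unitFrame n (k s)) (y := fun n s => W.unitFrame n s)
      ((continuous_eval a).comp k.continuous) (fun s => isCompactOperator_eval a _) (fun s v => ?_)
      (fun s v => ?_) hcV (fun n s h => W.continuousAt_unitFrame (mt (h0' n s).2 h))
      (fun n s => hu s n) hn
    · rw [V.closure_span_unitFrame, hV]; exact eval_apply_mem ha _ _
    · rw [V.closure_span_unitFrame, hV]; exact star_eval_apply_mem ha _ _
  · have h1 := continuous_conj (x := fun n s => W.unitFrame n s) (y := fun n s => V.unitFrame n (k s))
      (u := fun s => star (u s)) (continuous_eval b) (fun s => isCompactOperator_eval b _)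
      (fun s v => by rw [W.closure_span_unitFrame, hW]; exact eval_apply_mem hb _ _)
      (fun s v => by rw [W.closure_span_unitFrame, hW]; exact star_eval_apply_mem hb _ _)
      (fun n s h => W.continuousAt_unitFrame h) (fun n s h => hcV n s (mt (h0' n s).1 h))
      (fun n s => hu' s n) (fun s => by rw [norm_star]; exact hn s)
    simpa using h1

end

end HereditaryInterval

end

open HereditaryInterval in
theorem theorem8p1p7
    (A B : NonUnitalStarSubalgebra ℂ StableInterval)
    (hA : IsHereditary A) (hA' : IsFull A)
    (hB : IsHereditary B) (hB' : IsFull B)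
    (α : unitInterval ≃ₜ Spectrum A) (β : unitInterval ≃ₜ Spectrum B)
    (f : unitInterval → ℕ∞)
    (hα : ∀ t, (α t).dim = f t) (hβ : ∀ t, (β t).dim = f t) :
    ∃ φ : A ≃⋆ₐ[ℂ] B, ∀ t, Spectrum.comap φ (β t) = α t := by
  obtain ⟨g, hg⟩ := exists_homeomorph_fiberPoint hA hA' α
  obtain ⟨h, hh⟩ := exists_homeomorph_fiberPoint hB hB' β
  -- α(t) sits at g(t) and β(t) at h(t), so the point s for `B` corresponds to g(h⁻¹(s)) for `A`;
  -- both fibres have dimension f(h⁻¹(s)).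
  have hk : ∀ s, Cardinal.toENat (Module.rank ℂ (essSpace A ((h.symm.trans g) s)))
      = Cardinal.toENat (Module.rank ℂ (essSpace B s)) := fun s => by
    have h1 := (hα (h.symm s)).trans (hβ (h.symm s)).symm
    rw [hg, hh, Homeomorph.apply_symm_apply] at h1
    exact h1
  obtain ⟨u, hu⟩ := exists_fieldIso A B (h.symm.trans g) hk
  refine ⟨hu.starAlgEquiv hA hB, fun t => ?_⟩
  rw [hh, hu.comap_starAlgEquiv hA hA' hB hB', hg]
  simp
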